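/- **Tile systems.** A \emph{glue} is a pair (label, strength) with label a finite string and strength in $\mathbb N$; a \emph{tile type} is a quadruple of glues (north, east, south, west). An \emph{assembly} over a finite tile set $T$ is a partial function $\alpha:\mathbb Z^2\dashrightarrow T$. Tiles at neighbouring points are bonded, with weight the common strength, if their abutting glues are equal and have positive strength. $\alpha$ is \emph{$\tau$-stable} if every cut of the resulting weighted graph on $\mathrm{dom}\,\alpha$ has weight at least $\tau$. The \emph{supertile} of $\alpha$ is the set $\tilde\alpha$ of all its translations. $C^\tau_{\tilde\alpha,\tilde\beta}$ is the set of supertiles of the $\tau$-stable unions $\alpha\cup\beta$ with $\alpha\in\tilde\alpha$, $\beta\in\tilde\beta$ and $\mathrm{dom}\,\alpha\cap\mathrm{dom}\,\beta=\emptyset$. A \emph{2HAM system} is a triple $\mathcal T=(T,S,\tau)$, where $T$ is a finite tile set, $\tau\in\mathbb N$ is the temperature, and the initial state $S$ is a finite set of supertiles of finite non-empty $\tau$-stable assemblies over $T$, each present in infinitely many copies. $\mathrm{2HAM}(\tau)$ is the class of all 2HAM systems at temperature $\tau$. The supertiles that arise from $S$ by finitely many combinations are the finitely producible ones; $\mathcal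 A[\mathcal T]$ is the set of all \emph{producible} supertiles, i.e. the results (unions) of finite or infinite sequences of assemblies that start with an assembly whose supertile is in $S$ and in which each assembly arises from the previous one by stable attachment of a disjoint assembly with finitely producible supertile. We write $\tilde\alpha\to^1_{\mathcal T}\tilde\beta$ if $\tilde\beta\in C^\tau_{\tilde\alpha,\tilde\gamma}$ for some $\tilde\gamma\in\mathcal A[\mathcal T]$, $\tilde\alpha\to^{\le1}_{\mathcal T}\tilde\beta$ if $\tilde\alpha=\tilde\beta$ or $\tilde\alpha\to^1_{\mathcal T}\tilde\beta$, and $\tilde\alpha\to_{\mathcal T}\tilde\beta$ if $\tilde\beta$ is the result of a finite (possibly empty) or infinite sequence of stable attachments of producible supertiles, starting from $\tilde\alpha$. **Simulation.** Let $\mathcal U=(U,S',\tau')$ and $\mathcal T=(T,S,\tau)$ be 2HAM systems, $m\ge1$, and let $R$ be a partial function from the $m$-blocks over $U$ (partial functions $\{0,\dots,m-1\}^2\dashrightarrow U$) to $T$. For an assembly $\alpha$ over $U$ and $(x,y)\in\mathbb Z^2$ let $\alpha^m_{x,y}(i,j)=\alpha(mx+i,my+j)$ be its block with index $(x,y)$,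 let $R^*(\alpha)$ be the assembly $(x,y)\mapsto R(\alpha^m_{x,y})$, and let $\tilde R(\tilde\alpha)=\{R^*(\alpha):\alpha\in\tilde\alpha\}$. Say that $\tilde\alpha$ \emph{maps cleanly} if $\tilde R(\tilde\alpha)$ is a supertile over $T$ and, for some $\alpha\in\tilde\alpha$ (a suitable alignment with the grid of blocks), either each non-empty block of $\alpha$ has an index that is in, or is a horizontal or vertical neighbour of a point of, $\mathrm{dom}\,R^*(\alpha)$, or $\alpha$ has at most one non-empty block. Consider the following conditions. 1. $\{\tilde R(\tilde\alpha):\tilde\alpha\in\mathcal A[\mathcal U]\}=\mathcal A[\mathcal T]$, and every $\tilde\alpha\in\mathcal A[\mathcal U]$ maps cleanly. 2. If $\tilde\alpha,\tilde\beta\in\mathcal A[\mathcal U]$ and $\tilde\alpha\to^1_{\mathcal U}\tilde\beta$, then $\tilde R(\tilde\alpha)\to^{\le1}_{\mathcal T}\tilde R(\tilde\beta)$. 3. If $\tilde\alpha,\tilde\beta\in\mathcal A[\mathcal T]$, $\tilde\alpha\to^1_{\mathcal T}\tilde\beta$, $\tilde\alpha'\in\mathcal A[\mathcal U]$ and $\tilde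 R(\tilde\alpha')=\tilde\alpha$, then there are $\tilde\alpha'',\tilde\beta'\in\mathcal A[\mathcal U]$ with $\tilde\alpha'\to_{\mathcal U}\tilde\alpha''\to^1_{\mathcal U}\tilde\beta'$, $\tilde R(\tilde\alpha'')=\tilde\alpha$ and $\tilde R(\tilde\beta')=\tilde\beta$. 4. If $\tilde\alpha,\tilde\beta\in\mathcal A[\mathcal T]$, $\tilde\gamma\in C^\tau_{\tilde\alpha,\tilde\beta}$, $\tilde\alpha',\tilde\beta'\in\mathcal A[\mathcal U]$, $\tilde R(\tilde\alpha')=\tilde\alpha$ and $\tilde R(\tilde\beta')=\tilde\beta$, then there are $\tilde\alpha'',\tilde\beta'',\tilde\gamma'\in\mathcal A[\mathcal U]$ with $\tilde\alpha'\to_{\mathcal U}\tilde\alpha''$, $\tilde\beta'\to_{\mathcal U}\tilde\beta''$, $\tilde R(\tilde\alpha'')=\tilde\alpha$, $\tilde R(\tilde\beta'')=\tilde\beta$, $\tilde R(\tilde\gamma')=\tilde\gamma$ and $\tilde\gamma'\in C^{\tau'}_{\tilde\alpha'',\tilde\beta''}$. $\mathcal U$ \emph{simulates} $\mathcal T$ at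 scale $m$ by means of $R$ if 1, 2 and 3 hold, and \emph{strongly simulates} $\mathcal T$ if 1, 2 and 4 hold. **Intrinsic universality.** A finite tile set $U$ is \emph{intrinsically universal} at temperature $\tau'$ for a class $\mathfrak C$ of 2HAM systems (with respect to simulation or to strong simulation) if there are computable functions that assign to (a finite description of) each $\mathcal T=(T,S,\tau)\in\mathfrak C$ a scale $m\ge1$, an $m$-block representation function $R$ into $T$, and a finite set $S_{\mathcal T}$ of supertiles of finite non-empty $\tau'$-stable assemblies over $U$, such that $(U,S_{\mathcal T},\tau')$ simulates (respectively, strongly simulates) $\mathcal T$ at scale $m$ by means of $R$, and each $\tilde\alpha\in S_{\mathcal T}$ represents an initial supertile $\tilde R(\tilde\alpha)\in S$ and has at most $m^2$ tiles per represented tile, $|\tilde\alpha|\le m^2\,|\tilde R(\tilde\alpha)|$. **Theorem.** For every integer $\tau\ge2$ there is a finite tile set $U_\tau$ that is intrinsically universal at temperature $\tau$ for the class $\mathrm{2HAM}(\tau)$, with respect to simulation and also with respect to strong simulation. -/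

import Mathlib

/-! ### Tiles, assemblies, supertiles -/

/-- A glue: a label (a finite string) together with a strength. -/
abbrev Glue : Type := List Bool × ℕ

/-- A tile type: its north, east, south and west glues. Tiles are not rotated. -/
abbrev TileType : Type := Glue × Glue × Glue × Glue

/-- The glue of `t` on the side with outward unit normal `d`
(a glue of strength zero when `d` is not a unit vector). -/
def TileType.glue (t : TileType) (d : ℤ × ℤ) : Glue :=
  if d = (0, 1) then t.1
  else if d = (1, 0) then t.2.1
  else if d = (0, -1) then t.2.2.1
  else if d = (-1, 0) then t.2.2.2
  else ([], 0)

/-- An assembly: a partial placement of tiles on the integer lattice. -/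
abbrev Assembly : Type := ℤ × ℤ → Option TileType

namespace Assembly

/-- The set of occupied lattice points. -/
def dom (α : Assembly) : Set (ℤ × ℤ) := {p | (α p).isSome}

/-- All tiles of `α` are of a type in `T`. -/
def Over (T : Finset TileType) (α : Assembly) : Prop := ∀ p t, α p = some t → t ∈ T

/-- The translation `α + u`. -/
def translate (α : Assembly) (u : ℤ × ℤ) : Assembly := fun p => α (p - u)

/-- The union, with preference to `α`. -/
def union (α β : Assembly) : Assembly := fun p => (α p).or (β p)

/-- The strength of the bond between the tiles of `α` at `p` and `q`: the strength of the
two abutting glues if these are equal, and zero if they differ, if `p` and `q` are not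
neighbours, or if one of the two points is not occupied. -/
def bond (α : Assembly) (p q : ℤ × ℤ) : ℕ :=
  match α p, α q with
  | some s, some t =>
      if TileType.glue s (q - p) = TileType.glue t (p - q) then (TileType.glue s (q - p)).2
      else 0
  | _, _ => 0

/-- `τ`-stability: every cut of the binding graph has weight at least `τ`. A cut is given by
one of its sides `X`; its (possibly infinite) weight is at least `τ` if finitely many of the
edges `(p, q)` from `X` to the other side already have total strength at least `τ`. -/
def Stable (τ : ℕ) (α : Assembly) : Prop :=
  ∀ X : Set (ℤ × ℤ), X ⊆ α.dom → X.Nonempty → X ≠ α.dom →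
    ∃ F : Finset ((ℤ × ℤ) × (ℤ × ℤ)),
      (∀ e ∈ F, e.1 ∈ X ∧ e.2 ∈ α.dom \ X) ∧ τ ≤ ∑ e ∈ F, α.bond e.1 e.2

/-- The supertile of `α`: the set of all its translations. -/
def supertile (α : Assembly) : Set Assembly := {β | ∃ u, α.translate u = β}

end Assembly

/-- The combination set of two supertiles at temperature `τ`. -/
def combination (τ : ℕ) (A B : Set Assembly) : Set (Set Assembly) :=
  {G | ∃ α ∈ A, ∃ β ∈ B, Disjoint α.dom β.dom ∧ (α.union β).Stable τ ∧
    G = (α.union β).supertile}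

/-! ### Two-handed tile assembly systems -/

/-- A two-handed tile assembly system. The initial state is a set of supertiles, each of
which is present in infinitely many copies. -/
structure TAS where
  tiles : Finset TileType
  init : Set (Set Assembly)
  temp : ℕ

namespace TAS

/-- The initial state consists of finitely many supertiles, which are the supertiles of
finite, non-empty, stable assemblies over the tile set. -/
def WellFormed (S : TAS) : Prop :=
  S.init.Finite ∧ ∀ A ∈ S.init, ∃ α : Assembly, A = α.supertile ∧ α.dom.Finite ∧
    α.dom.Nonempty ∧ α.Over S.tiles ∧ α.Stable S.temp

/-- The supertiles that arise after finitely many attachments: those of the initial state,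
and the stable combinations of two such supertiles. -/
inductive FinProducible (S : TAS) : Set Assembly → Prop
  | init {A : Set Assembly} : A ∈ S.init → FinProducible S A
  | combine {A B G : Set Assembly} : FinProducible S A → FinProducible S B →
      G ∈ combination S.temp A B → FinProducible S G

/-- A growth sequence: at each step either nothing is attached, or an assembly whose
supertile is in `P` is attached stably. Finite sequences are those that become constant. -/
def IsGrowth (S : TAS) (P : Set (Set Assembly)) (a : ℕ → Assembly) : Prop :=
  ∀ i, a (i + 1) = a i ∨ ∃ β : Assembly, β.supertile ∈ P ∧ Disjoint (a i).dom β.dom ∧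
    a (i + 1) = (a i).union β ∧ (a (i + 1)).Stable S.temp

/-- `γ` is the union of the increasing sequence `a`. -/
def IsResult (a : ℕ → Assembly) (γ : Assembly) : Prop :=
  ∀ p t, γ p = some t ↔ ∃ i, a i p = some t

/-- The producible supertiles, finite or infinite: the results of the finite and infinite
growth sequences that start in the initial state. -/
def producible (S : TAS) : Set (Set Assembly) :=
  {G | ∃ (a : ℕ → Assembly) (γ : Assembly), (a 0).supertile ∈ S.init ∧
    S.IsGrowth {B | S.FinProducible B} a ∧ IsResult a γ ∧ G = γ.supertile}

/-- `A → B`: a finite or infinite sequence of attachments of producible supertiles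
leads from `A` to `B`. -/
def Grows (S : TAS) (A B : Set Assembly) : Prop :=
  ∃ (a : ℕ → Assembly) (γ : Assembly), A = (a 0).supertile ∧
    S.IsGrowth S.producible a ∧ IsResult a γ ∧ B = γ.supertile

/-- `A →¹ B`: a single attachment of a producible supertile leads from `A` to `B`. -/
def Step (S : TAS) (A B : Set Assembly) : Prop :=
  ∃ X ∈ S.producible, B ∈ combination S.temp A X

/-- `A →^{≤ 1} B`. -/
def StepLE (S : TAS) (A B : Set Assembly) : Prop := A = B ∨ S.Step A B

end TAS

/-! ### Simulation -/

/-- An `m`-block over a tile set, written out as the list of its `m` rows (from south to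
north), each of which is a list of `m` possibly empty cells (from west to east). -/
abbrev Block : Type := List (List (Option TileType))

/-- The `m`-block of `α` with index `(x, y)`; its cell `(i, j)` is `α (m x + i, m y + j)`. -/
def Assembly.block (m : ℕ) (α : Assembly) (x y : ℤ) : Block :=
  (List.range m).map fun j => (List.range m).map fun i => α (m * x + i, m * y + j)

/-- The `m`-block of `α` with index `(x, y)` is not empty. -/
def Assembly.BlockNonempty (m : ℕ) (α : Assembly) (x y : ℤ) : Prop :=
  ∃ i j : ℕ, i < m ∧ j < m ∧ (m * x + i, m * y + j) ∈ α.dom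

/-- The assembly representation function `R*` of an `m`-block representation function. -/
def repAssembly (m : ℕ) (R : Block → Option TileType) (α : Assembly) : Assembly :=
  fun p => R (α.block m p.1 p.2)

/-- The supertile representation function: the images of all translations. -/
def repSupertile (m : ℕ) (R : Block → Option TileType) (A : Set Assembly) : Set Assembly :=
  repAssembly m R '' A

/-- `α` maps cleanly to `β`: fuzz is only directly north, east, south or west of a block
that represents a tile, or `α` has at most one non-empty block. -/
def CleanTo (m : ℕ) (α β : Assembly) : Prop :=
  (∀ x y : ℤ, α.BlockNonempty m x y →
    ∃ u v : ℤ, u ∈ ({-1, 0, 1} : Set ℤ) ∧ v ∈ ({-1, 0, 1} : Set ℤ) ∧ u ^ 2 + v ^ 2 < 2 ∧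
      (x + u, y + v) ∈ β.dom) ∨
  (∀ x y x' y' : ℤ, α.BlockNonempty m x y → α.BlockNonempty m x' y' → x = x' ∧ y = y')

/-- The supertile `A` maps cleanly to a supertile over `T`. The images of all translations of
the assembly have to form one supertile; fuzz is measured in a suitable alignment of the
assembly with the grid of blocks. -/
def MapsCleanly (m : ℕ) (R : Block → Option TileType) (T : Finset TileType)
    (A : Set Assembly) : Prop :=
  (∃ β : Assembly, β.Over T ∧ repSupertile m R A = β.supertile) ∧
    ∃ α ∈ A, CleanTo m α (repAssembly m R α)

/-- `U` and `S` have equivalent productions. -/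
def EquivalentProductions (m : ℕ) (R : Block → Option TileType) (U S : TAS) : Prop :=
  {B | ∃ A ∈ U.producible, repSupertile m R A = B} = S.producible ∧
    ∀ A ∈ U.producible, MapsCleanly m R S.tiles A

/-- `S` follows `U`. -/
def Follows (m : ℕ) (R : Block → Option TileType) (U S : TAS) : Prop :=
  ∀ A ∈ U.producible, ∀ B ∈ U.producible, U.Step A B →
    S.StepLE (repSupertile m R A) (repSupertile m R B)

/-- `U` weakly models `S`. -/
def WeaklyModels (m : ℕ) (R : Block → Option TileType) (U S : TAS) : Prop :=
  ∀ A ∈ S.producible, ∀ B ∈ S.producible, S.Step A B →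
    ∀ A' ∈ U.producible, repSupertile m R A' = A →
      ∃ A'' ∈ U.producible, repSupertile m R A'' = A ∧ U.Grows A' A'' ∧
        ∃ B' ∈ U.producible, U.Step A'' B' ∧ repSupertile m R B' = B

/-- `U` strongly models `S`. -/
def StronglyModels (m : ℕ) (R : Block → Option TileType) (U S : TAS) : Prop :=
  ∀ A ∈ S.producible, ∀ B ∈ S.producible, ∀ G ∈ combination S.temp A B,
    ∀ A' ∈ U.producible, ∀ B' ∈ U.producible,
      repSupertile m R A' = A → repSupertile m R B' = B →
        ∃ A'' ∈ U.producible, ∃ B'' ∈ U.producible, ∃ G' ∈ U.producible,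
          U.Grows A' A'' ∧ U.Grows B' B'' ∧ repSupertile m R A'' = A ∧
          repSupertile m R B'' = B ∧ repSupertile m R G' = G ∧
          G' ∈ combination U.temp A'' B''

/-- `U` simulates `S` at scale `m` with representation function `R`. -/
def Simulates (m : ℕ) (R : Block → Option TileType) (U S : TAS) : Prop :=
  EquivalentProductions m R U S ∧ Follows m R U S ∧ WeaklyModels m R U S

/-- `U` strongly simulates `S` at scale `m` with representation function `R`. -/
def StronglySimulates (m : ℕ) (R : Block → Option TileType) (U S : TAS) : Prop :=
  EquivalentProductions m R U S ∧ Follows m R U S ∧ StronglyModels m R U S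

/-! ### Intrinsic universality -/

/-- A finite assembly, as a finite list of placed tiles. -/
abbrev FinAssembly : Type := List ((ℤ × ℤ) × TileType)

/-- The assembly that is described by a list (where the first entry for a point counts). -/
def FinAssembly.toAssembly (l : FinAssembly) : Assembly := fun p => l.lookup p

/-- The set of supertiles that is described by a list of finite assemblies. -/
def stateOf (L : List FinAssembly) : Set (Set Assembly) :=
  {A | ∃ l ∈ L, A = (FinAssembly.toAssembly l).supertile}

/-- A finite description of a system: tile set, initial state, temperature. -/
abbrev Description : Type := List TileType × List FinAssembly × ℕ

/-- The system that is described by `d`. -/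
def Description.toTAS (d : Description) : TAS := ⟨d.1.toFinset, stateOf d.2.1, d.2.2⟩

/-- The tile set `U` is intrinsically universal at temperature `τ'` for the class `C` of
systems, with respect to the notion `sim` of simulation: from any finite description of a
system `S` in `C`, one can compute a scale `m`, an `m`-block representation function `R`
into the tiles of `S`, and an initial state over `U`, such that `U` with this initial state
and at temperature `τ'` simulates `S` at scale `m` by means of `R`. Moreover, every initial
supertile of the simulator represents an initial supertile of `S` and has on average at most
`m * m` tiles for each represented tile. -/
def IntrinsicallyUniversal (sim : ℕ → (Block → Option TileType) → TAS → TAS → Prop)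
    (U : Finset TileType) (τ' : ℕ) (C : Set TAS) : Prop :=
  ∃ (scale : Description → ℕ) (rep : Description → Block → Option TileType)
    (start : Description → List FinAssembly),
    Computable scale ∧ Computable₂ rep ∧ Computable start ∧
    ∀ S ∈ C, ∀ d : Description, d.toTAS = S →
      0 < scale d ∧
      (∀ b t, rep d b = some t → t ∈ S.tiles) ∧
      (TAS.mk U (stateOf (start d)) τ').WellFormed ∧
      (∀ A ∈ stateOf (start d), repSupertile (scale d) (rep d) A ∈ S.init ∧
        ∀ α ∈ A, α.dom.ncard ≤ scale d ^ 2 * (repAssembly (scale d) (rep d) α).dom.ncard) ∧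
      sim (scale d) (rep d) ⟨U, stateOf (start d), τ'⟩ S

/-- The class 2HAM(τ) of all two-handed tile assembly systems at temperature `τ`. -/
def TwoHAM (τ : ℕ) : Set TAS := {S | S.WellFormed ∧ S.temp = τ}

/-! Every tile is replaced by a macrotile, a rigid square of side `2 * n + 4` whose internal bonds
all have strength `τ`, and the simulator starts from the initial supertiles expanded in this way.
Here `n` is the code of the simulated tile list, which bounds the codes of its tiles and glues. A
fixed tile set suffices because the information is stored in positions: each side of the square has
one port cell, whose place encodes the glue of the represented tile, while the glue at the port has
a fixed label and the original strength truncated at `τ`.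

Ports alone would allow macrotiles to bond at a wrong offset. A bump on the east and north sides,
with matching dents opposite, prevents this: if two ports in different places faced each other, the
bump of one square would lie on a cell of the other (`touch_east`, `touch_north`). Hence bonded
macrotiles are aligned and the represented glues agree. Bonds between macrotiles are then the
truncated bonds between the represented tiles, and a cut through a macrotile is crossed by a bond of
strength `τ`, so expansion preserves and reflects stability (`stable_expand`). With
`aligned_of_stable` it follows that expansion commutes with combination
(`mem_combination_expandSet`), and that the producible supertiles of the simulator are exactly the
expansions of those of the simulated system (`producible_eq`).

The representation function must read macrotiles in every alignment with the grid. One row of a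
macrotile therefore carries a centre and, on both sides at distance `encode t + 1`, a mark. A block
that contains the centre has room for at least one of the marks, and the distance determines `t`
(`shows_iff`). So each translate of an expansion represents a translate of the original
(`repAssembly_expand`).

Representation thus inverts expansion on supertiles, and the simulation conditions hold without any
preparatory growth. Strong simulation needs, in addition, that a stable combination of two possibly
infinite producible supertiles is producible (`producible_of_mem_combination`). -/

namespace Assembly

/-! ### Translations, unions and cuts of assemblies. -/

variable {α β γ α' β' : Assembly} {τ : ℕ} {p q u v : ℤ × ℤ} {t : TileType}

theorem mem_dom : p ∈ α.dom ↔ ∃ t, α p = some t := Option.isSome_iff_exists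

theorem notMem_dom : p ∉ α.dom ↔ α p = none := by
  simp [dom]

theorem translate_zero : α.translate 0 = α := by
  funext p; simp [translate]

theorem translate_translate : (α.translate u).translate v = α.translate (u + v) := by
  funext p; simp only [translate]; congr 1; abel

theorem mem_dom_translate : p ∈ (α.translate u).dom ↔ p - u ∈ α.dom := Iff.rfl

theorem translate_union : (α.union β).translate u = (α.translate u).union (β.translate u) := rfl

theorem bond_translate : (α.translate u).bond p q = α.bond (p - u) (q - u) := by
  simp only [bond, translate]
  rw [show q - p = q - u - (p - u) by abel, show p - q = p - u - (q - u) by abel]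

theorem bond_eq_of_eq_some {s : TileType} (hp : α p = some s) (hq : α q = some t) :
    α.bond p q = if s.glue (q - p) = t.glue (p - q) then (s.glue (q - p)).2 else 0 := by
  simp only [bond, hp, hq]

theorem exists_of_bond_pos (h : 0 < α.bond p q) : ∃ s t, α p = some s ∧ α q = some t ∧
    s.glue (q - p) = t.glue (p - q) ∧ α.bond p q = (s.glue (q - p)).2 := by
  unfold bond at h ⊢
  split at h
  · rename_i s t hs ht
    split at h
    · rename_i hg
      exact ⟨s, t, hs, ht, hg, by simp [hg]⟩
    · simp at h
  · simp at h

theorem bond_comm : α.bond p q = α.bond q p := by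
  unfold bond
  cases α p <;> cases α q <;> try rfl
  rename_i s t
  simp only
  by_cases h : s.glue (q - p) = t.glue (p - q)
  · rw [if_pos h, if_pos h.symm, h]
  · rw [if_neg h, if_neg (Ne.symm h)]

theorem bond_congr (hp : α p = β p) (hq : α q = β q) : α.bond p q = β.bond p q := by
  simp only [bond, hp, hq]

theorem mem_supertile_self : α ∈ α.supertile := ⟨0, translate_zero⟩

theorem supertile_translate : (α.translate u).supertile = α.supertile := by
  ext β
  constructor
  · rintro ⟨v, rfl⟩; exact ⟨u + v, translate_translate.symm⟩
  · rintro ⟨v, rfl⟩; exact ⟨v - u, by rw [translate_translate]; congr 1; abel⟩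

theorem exists_of_supertile_eq (h : α.supertile = β.supertile) : ∃ u, α.translate u = β := by
  have : β ∈ α.supertile := h ▸ mem_supertile_self
  exact this

theorem dom_union : (α.union β).dom = α.dom ∪ β.dom := by
  ext p; simp [dom, union]

theorem union_eq_some_iff (h : Disjoint α.dom β.dom) :
    α.union β p = some t ↔ α p = some t ∨ β p = some t := by
  have hp : p ∈ α.dom → p ∉ β.dom := fun hp => Set.disjoint_left.1 h hp
  simp only [mem_dom] at hp
  unfold union
  cases ha : α p <;> simp_all

theorem union_left (hp : p ∈ α.dom) : α.union β p = α p := by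
  obtain ⟨t, ht⟩ := mem_dom.1 hp
  simp [union, ht]

theorem union_right (h : Disjoint α.dom β.dom) (hp : p ∈ β.dom) : α.union β p = β p := by
  have := notMem_dom.1 (Set.disjoint_right.1 h hp)
  simp [union, this]

theorem union_comm (h : Disjoint α.dom β.dom) : α.union β = β.union α := by
  funext p
  apply Option.ext
  intro t
  rw [union_eq_some_iff h, union_eq_some_iff h.symm, or_comm]

theorem union_assoc : (α.union β).union γ = α.union (β.union γ) := by
  funext p; simp [union, Option.or_assoc]

theorem disjoint_translate (h : Disjoint α.dom β.dom) :
    Disjoint (α.translate u).dom (β.translate u).dom :=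
  Set.disjoint_left.2 fun _ h1 h2 => Set.disjoint_left.1 h h1 h2

theorem Stable.translate (h : α.Stable τ) (u : ℤ × ℤ) : (α.translate u).Stable τ := by
  intro X hX hne hneq
  obtain ⟨F, hF, hs⟩ := h ((· + u) ⁻¹' X) (fun p hp => by simpa using mem_dom_translate.1 (hX hp))
    (by obtain ⟨x, hx⟩ := hne; exact ⟨x - u, by simpa using hx⟩)
    (fun h => hneq (by
      ext p
      have := Set.ext_iff.1 h (p - u)
      simpa [mem_dom_translate] using this))
  refine ⟨F.map (Equiv.addRight (u, u)).toEmbedding, ?_, ?_⟩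
  · intro e he
    obtain ⟨e', he', rfl⟩ := Finset.mem_map.1 he
    have := hF e' he'
    simpa [mem_dom_translate] using this
  · simpa [bond_translate] using hs

theorem Over.translate {T : Finset TileType} (h : α.Over T) (u : ℤ × ℤ) :
    (α.translate u).Over T := fun _ _ hp => h _ _ hp

theorem Over.union {T : Finset TileType} (h : α.Over T) (h' : β.Over T) :
    (α.union β).Over T := by
  intro p t hp
  simp only [Assembly.union, Option.or_eq_some_iff] at hp
  rcases hp with hp | ⟨-, hp⟩
  exacts [h _ _ hp, h' _ _ hp]

theorem dom_translate_nonempty (h : α.dom.Nonempty) : (α.translate u).dom.Nonempty := by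
  obtain ⟨p, hp⟩ := h
  exact ⟨p + u, by simpa [mem_dom_translate] using hp⟩

/-- Two stable assemblies that are joined by bonds of total strength `τ` form a stable one. -/
theorem Stable.union (ha : α.Stable τ) (hb : β.Stable τ) (hd : Disjoint α.dom β.dom)
    (F : Finset ((ℤ × ℤ) × (ℤ × ℤ))) (hF : ∀ e ∈ F, e.1 ∈ α.dom ∧ e.2 ∈ β.dom)
    (hs : τ ≤ ∑ e ∈ F, (α.union β).bond e.1 e.2) : (α.union β).Stable τ := by
  intro X hX hne hneq
  rw [dom_union] at hX hneq ⊢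
  -- A cut that splits one of the two parts is heavy enough within that part. Otherwise `X` is one
  -- of the two domains, and `F`, reversed if `X` is the second domain, crosses the cut.
  by_cases h1 : (X ∩ α.dom).Nonempty ∧ X ∩ α.dom ≠ α.dom
  · obtain ⟨G, hG, hGs⟩ := ha _ Set.inter_subset_right h1.1 h1.2
    refine ⟨G, fun e he => ?_, hGs.trans (Finset.sum_le_sum fun e he => ?_)⟩
    · obtain ⟨⟨h2, h3⟩, h4, h5⟩ := hG e he
      exact ⟨h2, Or.inl h4, fun h => h5 ⟨h, h4⟩⟩
    · obtain ⟨⟨h2, h3⟩, h4, h5⟩ := hG e he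
      exact (bond_congr (union_left h3) (union_left h4)).ge
  by_cases h2 : (X ∩ β.dom).Nonempty ∧ X ∩ β.dom ≠ β.dom
  · obtain ⟨G, hG, hGs⟩ := hb _ Set.inter_subset_right h2.1 h2.2
    refine ⟨G, fun e he => ?_, hGs.trans (Finset.sum_le_sum fun e he => ?_)⟩
    · obtain ⟨⟨h2, h3⟩, h4, h5⟩ := hG e he
      exact ⟨h2, Or.inr h4, fun h => h5 ⟨h, h4⟩⟩
    · obtain ⟨⟨h2, h3⟩, h4, h5⟩ := hG e he
      exact (bond_congr (union_right hd h3) (union_right hd h4)).ge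
  rw [not_and, not_not] at h1 h2
  have hda := Set.disjoint_left.1 hd
  have hdb := Set.disjoint_right.1 hd
  by_cases h3 : (X ∩ α.dom).Nonempty
  · have h3' := Set.inter_eq_right.1 (h1 h3)
    have h4 : ∀ p ∈ β.dom, p ∉ X := by
      intro p hp hpX
      have h4' := Set.inter_eq_right.1 (h2 ⟨p, hpX, hp⟩)
      exact hneq (subset_antisymm hX (Set.union_subset h3' h4'))
    exact ⟨F, fun e he => ⟨h3' (hF e he).1, Or.inr (hF e he).2, h4 _ (hF e he).2⟩, hs⟩
  · have h3' : ∀ p ∈ α.dom, p ∉ X := fun p hp hpX => h3 ⟨p, hpX, hp⟩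
    obtain ⟨x, hx⟩ := hne
    have hxb : x ∈ β.dom := (hX hx).resolve_left fun h => h3' x h hx
    have h4 := Set.inter_eq_right.1 (h2 ⟨x, hx, hxb⟩)
    refine ⟨F.map (Equiv.prodComm _ _).toEmbedding, fun e he => ?_, ?_⟩
    · obtain ⟨e', he', rfl⟩ := Finset.mem_map.1 he
      exact ⟨h4 (hF e' he').2, Or.inl (hF e' he').1, h3' _ (hF e' he').1⟩
    · rw [Finset.sum_map]
      exact hs.trans (Finset.sum_le_sum fun e _ => (bond_comm).le)

/-- This is the cut that separates the two parts. Finitely many bonds witness its weight even when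
the assemblies are infinite. -/
theorem Stable.exists_cross (h : (α.union β).Stable τ) (hd : Disjoint α.dom β.dom)
    (ha : α.dom.Nonempty) (hb : β.dom.Nonempty) :
    ∃ F : Finset ((ℤ × ℤ) × (ℤ × ℤ)), (∀ e ∈ F, e.1 ∈ α.dom ∧ e.2 ∈ β.dom) ∧
      τ ≤ ∑ e ∈ F, (α.union β).bond e.1 e.2 := by
  obtain ⟨F, hF, hs⟩ := h α.dom (by rw [dom_union]; exact Set.subset_union_left) ha (by
    intro h
    obtain ⟨x, hx⟩ := hb
    exact Set.disjoint_right.1 hd hx (by rw [h, dom_union]; exact Or.inr hx))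
  refine ⟨F, fun e he => ⟨(hF e he).1, ?_⟩, hs⟩
  have := (hF e he).2
  rw [dom_union] at this
  exact this.1.resolve_left this.2

end Assembly

open Assembly

theorem mem_combination_supertile {τ : ℕ} {α β : Assembly} {G : Set Assembly} :
    G ∈ combination τ α.supertile β.supertile ↔ ∃ u v,
      Disjoint (α.translate u).dom (β.translate v).dom ∧
      ((α.translate u).union (β.translate v)).Stable τ ∧
      G = ((α.translate u).union (β.translate v)).supertile := by
  constructor
  · rintro ⟨_, ⟨u, rfl⟩, _, ⟨v, rfl⟩, h⟩
    exact ⟨u, v, h⟩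
  · rintro ⟨u, v, h⟩
    exact ⟨_, ⟨u, rfl⟩, _, ⟨v, rfl⟩, h⟩

/-! ### Growth sequences and producible supertiles. -/

namespace TAS

variable {S : TAS} {P : Set (Set Assembly)} {a b : ℕ → Assembly} {γ γ' : Assembly}

/-- `α'` arises from `α` by the attachment of at most one assembly with supertile in `P`. -/
def Attach (S : TAS) (P : Set (Set Assembly)) (α α' : Assembly) : Prop :=
  α' = α ∨ ∃ β : Assembly, β.supertile ∈ P ∧ Disjoint α.dom β.dom ∧
    α' = α.union β ∧ α'.Stable S.temp

theorem Attach.mono {α α' : Assembly} (h : S.Attach P α α') {p : ℤ × ℤ} {t : TileType}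
    (hp : α p = some t) : α' p = some t := by
  rcases h with rfl | ⟨β, -, -, rfl, -⟩
  · exact hp
  · rw [union_left (mem_dom.2 ⟨t, hp⟩), hp]

theorem Attach.translate {α α' : Assembly} (h : S.Attach P α α') (u : ℤ × ℤ) :
    S.Attach P (α.translate u) (α'.translate u) := by
  rcases h with rfl | ⟨β, h1, h2, rfl, h4⟩
  · exact Or.inl rfl
  · exact Or.inr ⟨β.translate u, by rwa [supertile_translate], disjoint_translate h2, rfl,
      h4.translate u⟩

/-- The attached piece does not care about a further disjoint part `δ`, as long as the whole is
stable. This allows two growth sequences to be interleaved. -/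
theorem Attach.union {α α' δ : Assembly} (h : S.Attach P α α') (hd : Disjoint α'.dom δ.dom)
    (hs : (α'.union δ).Stable S.temp) : S.Attach P (α.union δ) (α'.union δ) := by
  rcases h with rfl | ⟨β, h1, h2, rfl, h4⟩
  · exact Or.inl rfl
  · rw [dom_union, Set.disjoint_union_left] at hd
    refine Or.inr ⟨β, h1, ?_, ?_, hs⟩
    · rw [dom_union, Set.disjoint_union_left]
      exact ⟨h2, hd.2.symm⟩
    · rw [union_assoc, union_assoc, union_comm hd.2]

theorem IsGrowth.attach (h : S.IsGrowth P a) (i : ℕ) : S.Attach P (a i) (a (i + 1)) := h i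

theorem IsGrowth.mono (h : S.IsGrowth P a) {i j : ℕ} (hij : i ≤ j) {p : ℤ × ℤ} {t : TileType}
    (hp : a i p = some t) : a j p = some t := by
  induction hij with
  | refl => exact hp
  | step _ ih => exact (h.attach _).mono ih

theorem IsGrowth.translate (h : S.IsGrowth P a) (u : ℤ × ℤ) :
    S.IsGrowth P fun i => (a i).translate u := fun i => (h.attach i).translate u

theorem IsGrowth.stable (h : S.IsGrowth P a) (h0 : (a 0).Stable S.temp) (i : ℕ) :
    (a i).Stable S.temp := by
  induction i with
  | zero => exact h0
  | succ i ih =>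
    rcases h i with h | ⟨_, _, _, _, h⟩
    · rwa [h]
    · exact h

theorem IsGrowth.finProducible (h : S.IsGrowth {B | S.FinProducible B} a)
    (h0 : S.FinProducible (a 0).supertile) (i : ℕ) : S.FinProducible (a i).supertile := by
  induction i with
  | zero => exact h0
  | succ i ih =>
    rcases h i with h | ⟨β, h1, h2, h3, h4⟩
    · rwa [h]
    · exact .combine ih h1 ⟨_, mem_supertile_self, _, mem_supertile_self, h2, h3 ▸ h4, by rw [h3]⟩

theorem IsResult.unique (h : IsResult a γ) (h' : IsResult a γ') : γ = γ' := by
  funext p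
  apply Option.ext
  intro t
  rw [h, h']

theorem IsResult.translate (h : IsResult a γ) (u : ℤ × ℤ) :
    IsResult (fun i => (a i).translate u) (γ.translate u) := fun p t => h (p - u) t

theorem IsGrowth.exists_result (h : S.IsGrowth P a) : ∃ γ, IsResult a γ := by
  classical
  refine ⟨fun p => if hp : ∃ t i, a i p = some t then some hp.choose else none, fun p t => ?_⟩
  constructor
  · intro hp
    simp only at hp
    split at hp
    · rename_i h1
      obtain ⟨i, hi⟩ := h1.choose_spec
      exact ⟨i, by rw [hi, hp]⟩
    · simp at hp
  · rintro ⟨i, hi⟩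
    have h1 : ∃ t i, a i p = some t := ⟨t, i, hi⟩
    simp only [dif_pos h1]
    obtain ⟨j, hj⟩ := h1.choose_spec
    have e1 := h.mono (le_max_left i j) hi
    have e2 := h.mono (le_max_right i j) hj
    exact e2.symm.trans e1

theorem IsResult.dom_subset (h : IsResult a γ) (i : ℕ) : (a i).dom ⊆ γ.dom := by
  intro p hp
  obtain ⟨t, ht⟩ := mem_dom.1 hp
  exact mem_dom.2 ⟨t, (h p t).2 ⟨i, ht⟩⟩

theorem IsResult.eventually_mem (hg : S.IsGrowth P a) (h : IsResult a γ) {p : ℤ × ℤ}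
    (hp : p ∈ γ.dom) : ∀ᶠ i in Filter.atTop, p ∈ (a i).dom ∧ a i p = γ p := by
  obtain ⟨t, ht⟩ := mem_dom.1 hp
  obtain ⟨i, hi⟩ := (h p t).1 ht
  filter_upwards [Filter.eventually_ge_atTop i] with j hj
  have := hg.mono hj hi
  exact ⟨mem_dom.2 ⟨t, this⟩, by rw [this, ht]⟩

/-- A growth sequence may be prolonged, from some point on, by another one. -/
theorem IsGrowth.append (ha : S.IsGrowth P a) (hb : S.IsGrowth P b) (N : ℕ)
    (h : S.Attach P (a N) (b 0)) :
    S.IsGrowth P fun k => if k ≤ N then a k else b (k - N - 1) := by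
  intro k
  change S.Attach P _ _
  rcases lt_trichotomy k N with hk | rfl | hk
  · simpa [hk.le, Nat.succ_le_of_lt hk] using ha.attach k
  · simpa using h
  · have h1 : ¬ k ≤ N := by omega
    have h2 : ¬ k + 1 ≤ N := by omega
    have h3 : k + 1 - N - 1 = k - N - 1 + 1 := by omega
    simp only [h1, h2, if_false, h3]
    exact hb.attach _

/-- The two results are held together by a finite set `F` of bonds, and all of them are present from
some stage `N` on in both sequences. Beyond that stage any union of a stage of `a` with a stage of
`b` is stable. So `a` is run up to `N`, then `b N` is attached as one finitely producible piece, and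
afterwards single steps of `a` and `b` alternate. -/
theorem producible_union (hS : S.WellFormed) (ha0 : (a 0).supertile ∈ S.init)
    (hb0 : (b 0).supertile ∈ S.init) (ha : S.IsGrowth {B | S.FinProducible B} a)
    (hb : S.IsGrowth {B | S.FinProducible B} b) (hra : IsResult a γ) (hrb : IsResult b γ')
    (hd : Disjoint γ.dom γ'.dom) (hst : (γ.union γ').Stable S.temp) :
    (γ.union γ').supertile ∈ S.producible := by
  have init_spec : ∀ α : Assembly, α.supertile ∈ S.init → α.Stable S.temp ∧ α.dom.Nonempty := by
    intro α hα
    obtain ⟨β, h1, -, h2, -, h3⟩ := hS.2 _ hα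
    obtain ⟨w, rfl⟩ := exists_of_supertile_eq h1.symm
    exact ⟨h3.translate w, dom_translate_nonempty h2⟩
  have hsa := ha.stable (init_spec _ ha0).1
  have hsb := hb.stable (init_spec _ hb0).1
  obtain ⟨F, hF, hFs⟩ := hst.exists_cross hd ((init_spec _ ha0).2.mono (hra.dom_subset 0))
    ((init_spec _ hb0).2.mono (hrb.dom_subset 0))
  have hdis : ∀ i j, Disjoint (a i).dom (b j).dom := fun i j =>
    hd.mono (hra.dom_subset i) (hrb.dom_subset j)
  obtain ⟨N, hN⟩ := Filter.eventually_atTop.1 ((Finset.eventually_all F).2 fun e he =>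
    (hra.eventually_mem ha (hF e he).1).and (hrb.eventually_mem hb (hF e he).2))
  have hab : ∀ i j, N ≤ i → N ≤ j → ((a i).union (b j)).Stable S.temp := by
    intro i j hi hj
    refine (hsa i).union (hsb j) (hdis i j) F
      (fun e he => ⟨(hN i hi e he).1.1, (hN j hj e he).2.1⟩) (hFs.trans (Finset.sum_le_sum ?_))
    intro e he
    obtain ⟨⟨h1, h2⟩, -⟩ := hN i hi e he
    obtain ⟨-, h3, h4⟩ := hN j hj e he
    refine (bond_congr ?_ ?_).le
    · rw [union_left h1, union_left (hF e he).1, h2]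
    · rw [union_right (hdis i j) h3, union_right hd (hF e he).2, h4]
  -- Even steps advance `a`, odd steps advance `b`.
  set d : ℕ → Assembly := fun r => (a (N + (r + 1) / 2)).union (b (N + r / 2)) with hddef
  have hdg : S.IsGrowth {B | S.FinProducible B} d := by
    intro r
    change S.Attach _ _ _
    obtain ⟨s, rfl | rfl⟩ := Nat.even_or_odd' r
    · have e1 : (2 * s + 1) / 2 = s := by omega
      have e2 : 2 * s / 2 = s := by omega
      have e3 : (2 * s + 1 + 1) / 2 = s + 1 := by omega
      simp only [hddef, e1, e2, e3]
      exact (ha.attach (N + s)).union (hdis _ _) (hab _ _ (by omega) (by omega))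
    · have e1 : (2 * s + 1) / 2 = s := by omega
      have e2 : (2 * s + 1 + 1) / 2 = s + 1 := by omega
      have e3 : (2 * s + 1 + 1 + 1) / 2 = s + 1 := by omega
      simp only [hddef, e1, e2, e3]
      rw [union_comm (hdis _ _), union_comm (hdis _ _)]
      exact (hb.attach (N + s)).union (hdis _ _).symm
        (union_comm (hdis _ _) ▸ hab _ _ (by omega) (by omega))
  have hd0 : S.Attach {B | S.FinProducible B} (a N) (d 0) :=
    Or.inr ⟨b N, hb.finProducible (.init hb0) N, hdis N N, by simp [hddef],
      by simpa [hddef] using hab N N le_rfl le_rfl⟩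
  refine ⟨_, _, ?_, ha.append hdg N hd0, ?_, rfl⟩
  · simpa using ha0
  · intro p t
    rw [union_eq_some_iff hd, hra, hrb]
    constructor
    · rintro (⟨i, hi⟩ | ⟨i, hi⟩)
      -- The appended sequence `d` starts at index `N + 1`, so this is `d (2 * i)`, where both
      -- sequences have reached stage `N + i`.
      · refine ⟨N + 2 * i + 1, ?_⟩
        have e1 : ¬ N + 2 * i + 1 ≤ N := by omega
        have e2 : N + 2 * i + 1 - N - 1 = 2 * i := by omega
        simp only [e1, if_false, e2, hddef]
        rw [union_eq_some_iff (hdis _ _)]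
        exact Or.inl (ha.mono (by omega) hi)
      · refine ⟨N + 2 * i + 1, ?_⟩
        have e1 : ¬ N + 2 * i + 1 ≤ N := by omega
        have e2 : N + 2 * i + 1 - N - 1 = 2 * i := by omega
        simp only [e1, if_false, e2, hddef]
        rw [union_eq_some_iff (hdis _ _)]
        exact Or.inr (hb.mono (by omega) hi)
    · rintro ⟨k, hk⟩
      replace hk : (if k ≤ N then a k else d (k - N - 1)) p = some t := hk
      split at hk
      · exact Or.inl ⟨_, hk⟩
      · simp only [hddef] at hk
        rw [union_eq_some_iff (hdis _ _)] at hk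
        exact hk.imp (fun h => ⟨_, h⟩) (fun h => ⟨_, h⟩)

/-- A stable combination of two producible supertiles, finite or infinite, is producible. -/
theorem producible_of_mem_combination (hS : S.WellFormed) {A B G : Set Assembly}
    (hA : A ∈ S.producible) (hB : B ∈ S.producible) (hG : G ∈ combination S.temp A B) :
    G ∈ S.producible := by
  obtain ⟨a, α, ha0, ha, hra, rfl⟩ := hA
  obtain ⟨b, β, hb0, hb, hrb, rfl⟩ := hB
  obtain ⟨u, v, hd, hst, rfl⟩ := mem_combination_supertile.1 hG
  exact producible_union hS (by rwa [supertile_translate]) (by rwa [supertile_translate])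
    (ha.translate u) (hb.translate v) (hra.translate u) (hrb.translate v) hd hst

end TAS

/-! ### Macrotiles -/

namespace MacroTile

open Assembly Encodable

variable {n τ : ℕ} {i j i' j' : ℕ} {p p' : ℤ × ℤ} {t t' : TileType} {α β : Assembly}

/-- The side length of the macrotiles; `n` is a bound for the codes of tiles and glues. -/
def side (n : ℕ) : ℕ := 2 * n + 4

/-- The shape of a macrotile: a square with one-cell dents in its west and south sides and
matching bumps on its east and north sides. -/
def Cell (n i j : ℕ) : Prop :=
  (i < 2 * n + 4 ∧ j < 2 * n + 4 ∧ ¬(i = 0 ∧ j = n + 2) ∧ ¬(i = n + 2 ∧ j = 0)) ∨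
    (i = 2 * n + 4 ∧ j = n + 2) ∨ (i = n + 2 ∧ j = 2 * n + 4)

instance : Decidable (Cell n i j) := by unfold Cell; infer_instance

/-- The cell `(i, j)` of the macrotile with index `p`. -/
def pos (n : ℕ) (p : ℤ × ℤ) (i j : ℕ) : ℤ × ℤ := (side n * p.1 + i, side n * p.2 + j)

theorem pos_ext {P : ℤ × ℤ} :
    P = pos n p i j ↔ P.1 = (2 * n + 4) * p.1 + i ∧ P.2 = (2 * n + 4) * p.2 + j := by
  simp [pos, side, Prod.ext_iff]

/-- Macrotiles cover the plane: division with remainder locates a point in a square, and the two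
dents are filled by the bumps of the western and southern neighbours. -/
theorem exists_pos (n : ℕ) (P : ℤ × ℤ) :
    ∃ q : (ℤ × ℤ) × ℕ × ℕ, Cell n q.2.1 q.2.2 ∧ P = pos n q.1 q.2.1 q.2.2 := by
  have hm : (0 : ℤ) < 2 * n + 4 := by omega
  obtain ⟨x, y⟩ := P
  have hx := Int.mul_ediv_add_emod x (2 * n + 4)
  have hy := Int.mul_ediv_add_emod y (2 * n + 4)
  have hx0 := Int.emod_nonneg x hm.ne'
  have hy0 := Int.emod_nonneg y hm.ne'
  have hx1 := Int.emod_lt_of_pos x hm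
  have hy1 := Int.emod_lt_of_pos y hm
  generalize x / (2 * n + 4) = a at *
  generalize y / (2 * n + 4) = b at *
  lift x % (2 * n + 4) to ℕ using hx0 with r hr
  lift y % (2 * n + 4) to ℕ using hy0 with s hs
  by_cases h1 : r = 0 ∧ s = n + 2
  · exact ⟨((a - 1, b), 2 * n + 4, n + 2), by simp [Cell], pos_ext.2
      ⟨by push_cast; rw [h1.1] at hx; push_cast at hx; linarith, by
        simp only; rw [← hy, h1.2]⟩⟩
  by_cases h2 : r = n + 2 ∧ s = 0
  · exact ⟨((a, b - 1), n + 2, 2 * n + 4), by simp [Cell], pos_ext.2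
      ⟨by simp only; rw [← hx, h2.1], by push_cast; rw [h2.2] at hy; push_cast at hy; linarith⟩⟩
  · exact ⟨((a, b), r, s), Or.inl ⟨by simp only; omega, by simp only; omega, h1, h2⟩,
      pos_ext.2 ⟨hx.symm, hy.symm⟩⟩

/-- Because of the bumps, coordinates within a macrotile may take the value `m` itself; quotient and
remainder are then ambiguous only between the remainders `0` and `m`. -/
theorem mul_add_cases {m a b r s : ℤ} (h : m * a + r = m * b + s) (hr : 0 ≤ r) (hr' : r ≤ m)
    (hs : 0 ≤ s) (hs' : s ≤ m) (hm : 0 < m) :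
    (a = b ∧ r = s) ∨ (a = b + 1 ∧ r = 0 ∧ s = m) ∨ (b = a + 1 ∧ s = 0 ∧ r = m) := by
  have h1 : m * (a - b) = s - r := by linear_combination h
  have h2 : a - b ≤ 1 := by
    by_contra hc
    have : m * 2 ≤ m * (a - b) := mul_le_mul_of_nonneg_left (by omega) hm.le
    omega
  have h3 : -1 ≤ a - b := by
    by_contra hc
    have : m * (a - b) ≤ m * (-2) := mul_le_mul_of_nonneg_left (by omega) hm.le
    omega
  have : a - b = 0 ∨ a - b = 1 ∨ a - b = -1 := by omega
  rcases this with h4 | h4 | h4 <;> rw [h4] at h1 <;> omega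

/-- Ambiguous coordinates occur only at a bump, and the competing cell of the neighbouring macrotile
would be its dent. -/
theorem pos_inj (h : Cell n i j) (h' : Cell n i' j') (e : pos n p i j = pos n p' i' j') :
    p = p' ∧ i = i' ∧ j = j' := by
  obtain ⟨e1, e2⟩ := pos_ext.1 e
  simp only [pos, side] at e1 e2
  push_cast at e1 e2
  have hi : i ≤ 2 * n + 4 := by rcases h with h | h | h <;> omega
  have hj : j ≤ 2 * n + 4 := by rcases h with h | h | h <;> omega
  have hi' : i' ≤ 2 * n + 4 := by rcases h' with h | h | h <;> omega
  have hj' : j' ≤ 2 * n + 4 := by rcases h' with h | h | h <;> omega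
  have c1 := mul_add_cases e1 (by omega) (by omega) (by omega) (by omega) (by omega)
  have c2 := mul_add_cases e2 (by omega) (by omega) (by omega) (by omega) (by omega)
  have : i = i' ∧ j = j' := by
    unfold Cell at h h'
    omega
  refine ⟨Prod.ext ?_ ?_, this⟩ <;> omega

/-- A property that is invariant under steps within a macrotile holds everywhere or nowhere
in the macrotile. -/
theorem cell_connected {f : ℕ → ℕ → Prop}
    (hh : ∀ i j, Cell n i j → Cell n (i + 1) j → (f i j ↔ f (i + 1) j))
    (hv : ∀ i j, Cell n i j → Cell n i (j + 1) → (f i j ↔ f i (j + 1)))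
    (h : Cell n i j) : f i j ↔ f 1 1 := by
  -- Cells with both coordinates positive, bumps aside, form a full square without dents, which is
  -- swept from its first row. The bumps and the remaining boundary cells adjoin it; only `(0, 0)`
  -- is reached through another boundary cell.
  have row : ∀ i, i < 2 * n + 3 → (f (i + 1) 1 ↔ f 1 1) := by
    intro i
    induction i with
    | zero => intro; rfl
    | succ i ih =>
      intro hi
      exact (hh (i + 1) 1 (Or.inl (by omega)) (Or.inl (by omega))).symm.trans (ih (by omega))
  have inner : ∀ i j, i < 2 * n + 3 → j < 2 * n + 3 → (f (i + 1) (j + 1) ↔ f 1 1) := by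
    intro i j hi
    induction j with
    | zero => intro; exact row i hi
    | succ j ih =>
      intro hj
      exact (hv (i + 1) (j + 1) (Or.inl (by omega)) (Or.inl (by omega))).symm.trans
        (ih (by omega))
  have west : ∀ j, j < 2 * n + 3 → j + 1 ≠ n + 2 → (f 0 (j + 1) ↔ f 1 1) := fun j hj hj' =>
    (hh 0 (j + 1) (Or.inl (by omega)) (Or.inl (by omega))).trans (inner 0 j (by omega) hj)
  have south : ∀ i, i < 2 * n + 3 → i + 1 ≠ n + 2 → (f (i + 1) 0 ↔ f 1 1) := fun i hi hi' =>
    (hv (i + 1) 0 (Or.inl (by omega)) (Or.inl (by omega))).trans (inner i 0 hi (by omega))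
  rcases h with ⟨h1, h2, h3, h4⟩ | ⟨rfl, rfl⟩ | ⟨rfl, rfl⟩
  · rcases i with _ | i <;> rcases j with _ | j
    · exact (hh 0 0 (Or.inl (by omega)) (Or.inl (by omega))).trans (south 0 (by omega) (by omega))
    · exact west j (by omega) (by omega)
    · exact south i (by omega) (by omega)
    · exact inner i j (by omega) (by omega)
  · exact (hh (2 * n + 3) (n + 2) (Or.inl (by omega)) (Or.inr (Or.inl ⟨rfl, rfl⟩))).symm.trans
      (inner (2 * n + 2) (n + 1) (by omega) (by omega))
  · exact (hv (n + 2) (2 * n + 3) (Or.inl (by omega)) (Or.inr (Or.inr ⟨rfl, rfl⟩))).symm.trans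
      (inner (n + 1) (2 * n + 2) (by omega) (by omega))

/-- The label of ordinary bonds within macrotiles. -/
def plain : List Bool := [false]
/-- The label of the bond that marks the centre of a macrotile. -/
def centre : List Bool := [true]
/-- The label of the bonds whose distance from the centre encodes the represented tile. -/
def mark : List Bool := [true, true]
/-- The label of the glues between macrotiles. -/
def port : List Bool := [false, false]

/-- The label of the bond between the cells `(i, j - 1)` and `(i, j)`, where `c` is the code of
the represented tile. -/
def label (n c i j : ℕ) : List Bool :=
  if j = 2 ∧ i = n + 2 then centre
  else if j = 2 ∧ (i + c + 1 = n + 2 ∨ i = n + 2 + c + 1) then mark else plain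

/-- The glue at the south of the cell `(i, j)` of the macrotile of `t`. -/
def vglue (n τ : ℕ) (t : TileType) (i j : ℕ) : Glue :=
  -- Internal bonds take precedence, which ties the bump to the square. The outer north side has `j
  -- = 2 * n + 4`, since glues are indexed by the cell above them. Truncating port strengths at `τ`
  -- keeps the number of glues finite.
  if 1 ≤ j ∧ Cell n i (j - 1) ∧ Cell n i j then (label n (encode t) i j, τ)
  else if j = 2 * n + 4 ∧ i = encode t.1 then (port, min t.1.2 τ)
  else if j = 0 ∧ i = encode t.2.2.1 then (port, min t.2.2.1.2 τ)
  else ([], 0)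

/-- The glue at the west of the cell `(i, j)` of the macrotile of `t`. -/
def hglue (n τ : ℕ) (t : TileType) (i j : ℕ) : Glue :=
  if 1 ≤ i ∧ Cell n (i - 1) j ∧ Cell n i j then (plain, τ)
  else if i = 2 * n + 4 ∧ j = encode t.2.1 then (port, min t.2.1.2 τ)
  else if i = 0 ∧ j = encode t.2.2.2 then (port, min t.2.2.2.2 τ)
  else ([], 0)

/-- The tile at the cell `(i, j)` of the macrotile of `t`. -/
def tile (n τ : ℕ) (t : TileType) (i j : ℕ) : TileType :=
  (vglue n τ t i (j + 1), hglue n τ t (i + 1) j, vglue n τ t i j, hglue n τ t i j)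

/-- The codes of `t` and of its glues are at most `n`. -/
def Fits (n : ℕ) (t : TileType) : Prop :=
  encode t ≤ n ∧ encode t.1 ≤ n ∧ encode t.2.1 ≤ n ∧ encode t.2.2.1 ≤ n ∧ encode t.2.2.2 ≤ n

/-! ### Contact of two macrotiles at an arbitrary offset. -/

theorem glue_east (t : TileType) : t.glue (1, 0) = t.2.1 := by simp [TileType.glue]
theorem glue_north (t : TileType) : t.glue (0, 1) = t.1 := by simp [TileType.glue]
theorem glue_west (t : TileType) : t.glue (-1, 0) = t.2.2.2 := by simp [TileType.glue]
theorem glue_south (t : TileType) : t.glue (0, -1) = t.2.2.1 := by simp [TileType.glue]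

theorem unit_of_glue_pos {d : ℤ × ℤ} (h : 0 < (t.glue d).2) :
    d = (1, 0) ∨ d = (0, 1) ∨ d = (-1, 0) ∨ d = (0, -1) := by
  unfold TileType.glue at h
  split_ifs at h with h1 h2 h3 h4 <;> simp_all

/-- Where two disjoint macrotiles at arbitrary offsets touch horizontally with a positive
strength, they are aligned, and the glues of the represented tiles agree. -/
theorem touch_east {u u' : ℤ × ℤ} (ht : Fits n t) (ht' : Fits n t')
    (h : Cell n i j) (h' : Cell n i' j')
    (hd : ∀ i j i' j' : ℕ, Cell n i j → Cell n i' j' →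
      ¬(u.1 + i = u'.1 + i' ∧ u.2 + j = u'.2 + j'))
    (ex : u.1 + i + 1 = u'.1 + i') (ey : u.2 + j = u'.2 + j')
    (hg : hglue n τ t (i + 1) j = hglue n τ t' i' j') (hs : 0 < (hglue n τ t (i + 1) j).2) :
    u'.1 = u.1 + (2 * n + 4) ∧ u'.2 = u.2 ∧ i = 2 * n + 3 ∧ j = encode t.2.1 ∧ i' = 0 ∧
      t.2.1 = t'.2.2.2 ∧ (hglue n τ t (i + 1) j).2 = min t.2.1.2 τ := by
  -- The point beyond the contact belongs to the other macrotile, so neither glue is internal and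
  -- both must be ports.
  have h1 : ¬ Cell n (i + 1) j := fun hc => hd _ _ _ _ hc h' ⟨by push_cast; omega, ey⟩
  have h2 : ¬ (1 ≤ i' ∧ Cell n (i' - 1) j') := fun hc => hd _ _ _ _ h hc.2 ⟨by omega, ey⟩
  have h1' : ¬ (1 ≤ i + 1 ∧ Cell n (i + 1 - 1) j ∧ Cell n (i + 1) j) := fun hc => h1 hc.2.2
  have e1 : i + 1 = 2 * n + 4 ∧ j = encode t.2.1 := by
    by_contra hc
    rw [hglue, if_neg h1', if_neg hc, if_neg (by omega)] at hs
    simp at hs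
  have hs' := hg ▸ hs
  have e2 : i' = 0 ∧ j' = encode t'.2.2.2 := by
    by_contra hc
    have h3 : ¬ (i' = 2 * n + 4 ∧ j' = encode t'.2.1) := by
      rintro ⟨rfl, rfl⟩
      have := ht'.2.2.1
      unfold Cell at h'
      omega
    have h4 : ¬ (1 ≤ i' ∧ Cell n (i' - 1) j' ∧ Cell n i' j') := fun hc => h2 ⟨hc.1, hc.2.1⟩
    rw [hglue, if_neg h4, if_neg h3, if_neg hc] at hs'
    simp at hs'
  have b1 := ht.2.2.1
  have b2 := ht'.2.2.2.2
  have e3 : j = j' := by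
    by_contra hc
    -- The east bump of the first macrotile lies at this cell of the west column of the second. As
    -- `j, j' ≤ n`, the row is within the square, and it misses the dent unless `j = j'`.
    refine hd (2 * n + 4) (n + 2) 0 (n + 2 + j' - j) (Or.inr (Or.inl ⟨rfl, rfl⟩))
      (Or.inl ⟨by omega, by omega, by omega, by omega⟩) ⟨?_, ?_⟩
    · push_cast; omega
    · rw [Nat.cast_sub (by omega)]; push_cast; omega
  refine ⟨by omega, by omega, by omega, e1.2, e2.1, encode_injective (by omega), ?_⟩
  rw [hglue, if_neg h1', if_pos e1]

/-- The mirror image of `touch_east`: here the north bump fixes the horizontal offset. -/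
theorem touch_north {u u' : ℤ × ℤ} (ht : Fits n t) (ht' : Fits n t')
    (h : Cell n i j) (h' : Cell n i' j')
    (hd : ∀ i j i' j' : ℕ, Cell n i j → Cell n i' j' →
      ¬(u.1 + i = u'.1 + i' ∧ u.2 + j = u'.2 + j'))
    (ex : u.1 + i = u'.1 + i') (ey : u.2 + j + 1 = u'.2 + j')
    (hg : vglue n τ t i (j + 1) = vglue n τ t' i' j') (hs : 0 < (vglue n τ t i (j + 1)).2) :
    u'.1 = u.1 ∧ u'.2 = u.2 + (2 * n + 4) ∧ i = encode t.1 ∧ j = 2 * n + 3 ∧ j' = 0 ∧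
      t.1 = t'.2.2.1 ∧ (vglue n τ t i (j + 1)).2 = min t.1.2 τ := by
  have h1 : ¬ Cell n i (j + 1) := fun hc => hd _ _ _ _ hc h' ⟨ex, by push_cast; omega⟩
  have h2 : ¬ (1 ≤ j' ∧ Cell n i' (j' - 1)) := fun hc => hd _ _ _ _ h hc.2 ⟨ex, by omega⟩
  have h1' : ¬ (1 ≤ j + 1 ∧ Cell n i (j + 1 - 1) ∧ Cell n i (j + 1)) := fun hc => h1 hc.2.2
  have e1 : j + 1 = 2 * n + 4 ∧ i = encode t.1 := by
    by_contra hc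
    rw [vglue, if_neg h1', if_neg hc, if_neg (by omega)] at hs
    simp at hs
  have hs' := hg ▸ hs
  have e2 : j' = 0 ∧ i' = encode t'.2.2.1 := by
    by_contra hc
    have h3 : ¬ (j' = 2 * n + 4 ∧ i' = encode t'.1) := by
      rintro ⟨rfl, rfl⟩
      have := ht'.2.1
      unfold Cell at h'
      omega
    have h4 : ¬ (1 ≤ j' ∧ Cell n i' (j' - 1) ∧ Cell n i' j') := fun hc => h2 ⟨hc.1, hc.2.1⟩
    rw [vglue, if_neg h4, if_neg h3, if_neg hc] at hs'
    simp at hs'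
  have b1 := ht.2.1
  have b2 := ht'.2.2.2.1
  have e3 : i = i' := by
    by_contra hc
    refine hd (n + 2) (2 * n + 4) (n + 2 + i' - i) 0 (Or.inr (Or.inr ⟨rfl, rfl⟩))
      (Or.inl ⟨by omega, by omega, by omega, by omega⟩) ⟨?_, ?_⟩
    · rw [Nat.cast_sub (by omega)]; push_cast; omega
    · push_cast; omega
  refine ⟨by omega, by omega, e1.2, by omega, e2.1, encode_injective (by omega), ?_⟩
  rw [vglue, if_neg h1', if_pos e1]

/-- The cell of the macrotile of `t` that carries the glue of `t` in direction `d`. -/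
def portCell (n : ℕ) (t : TileType) (d : ℤ × ℤ) : ℕ × ℕ :=
  if d = (1, 0) then (2 * n + 3, encode t.2.1)
  else if d = (0, 1) then (encode t.1, 2 * n + 3)
  else if d = (-1, 0) then (0, encode t.2.2.2)
  else (encode t.2.2.1, 0)

/-- Where two disjoint macrotiles at arbitrary offsets touch with a positive strength, they
are aligned, and the glues of the represented tiles agree. -/
theorem touch {u u' d : ℤ × ℤ} (ht : Fits n t) (ht' : Fits n t')
    (h : Cell n i j) (h' : Cell n i' j')
    (hd : ∀ i j i' j' : ℕ, Cell n i j → Cell n i' j' →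
      ¬(u.1 + i = u'.1 + i' ∧ u.2 + j = u'.2 + j'))
    (ex : u.1 + i + d.1 = u'.1 + i') (ey : u.2 + j + d.2 = u'.2 + j')
    (hg : (tile n τ t i j).glue d = (tile n τ t' i' j').glue (-d))
    (hs : 0 < ((tile n τ t i j).glue d).2) :
    u' = (u.1 + (2 * n + 4) * d.1, u.2 + (2 * n + 4) * d.2) ∧ (i, j) = portCell n t d ∧
      t.glue d = t'.glue (-d) ∧ ((tile n τ t i j).glue d).2 = min (t.glue d).2 τ := by
  -- Contacts to the west and south are contacts to the east and north with the roles exchanged.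
  have hd' : ∀ i j i' j' : ℕ, Cell n i j → Cell n i' j' →
      ¬(u'.1 + i = u.1 + i' ∧ u'.2 + j = u.2 + j') := fun i j i' j' h h' ⟨e1, e2⟩ =>
    hd i' j' i j h' h ⟨e1.symm, e2.symm⟩
  rcases unit_of_glue_pos hs with rfl | rfl | rfl | rfl
  · rw [show -((1 : ℤ), (0 : ℤ)) = (-1, 0) from rfl] at hg ⊢
    simp only [glue_east, glue_west, tile] at hg hs ex ey ⊢
    obtain ⟨e1, e2, e3, e4, e5, e6, e7⟩ := touch_east ht ht' h h' hd ex (by omega) hg hs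
    exact ⟨Prod.ext (by simp [e1]) (by simp [e2]), by simp [portCell, e3, e4], e6, e7⟩
  · rw [show -((0 : ℤ), (1 : ℤ)) = (0, -1) from rfl] at hg ⊢
    simp only [glue_north, glue_south, tile] at hg hs ex ey ⊢
    obtain ⟨e1, e2, e3, e4, e5, e6, e7⟩ := touch_north ht ht' h h' hd (by omega) ey hg hs
    exact ⟨Prod.ext (by simp [e1]) (by simp [e2]), by simp [portCell, e3, e4], e6, e7⟩
  · rw [show -((-1 : ℤ), (0 : ℤ)) = (1, 0) from rfl] at hg ⊢
    simp only [glue_east, glue_west, tile] at hg hs ex ey ⊢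
    obtain ⟨e1, e2, e3, e4, e5, e6, e7⟩ :=
      touch_east ht' ht h' h hd' (by omega) (by omega) hg.symm (hg ▸ hs)
    refine ⟨Prod.ext (by simp only; omega) (by simp only; omega), ?_, e6.symm, ?_⟩
    · have : j = j' := by omega
      simp [portCell, e5, this, e4, e6]
    · rw [hg, e7, e6]
  · rw [show -((0 : ℤ), (-1 : ℤ)) = (0, 1) from rfl] at hg ⊢
    simp only [glue_north, glue_south, tile] at hg hs ex ey ⊢
    obtain ⟨e1, e2, e3, e4, e5, e6, e7⟩ :=
      touch_north ht' ht h' h hd' (by omega) (by omega) hg.symm (hg ▸ hs)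
    refine ⟨Prod.ext (by simp only; omega) (by simp only; omega), ?_, e6.symm, ?_⟩
    · have : i = i' := by omega
      simp [portCell, e5, this, e3, e6]
    · rw [hg, e7, e6]

end MacroTile

/-! ### Expansion of assemblies, and the bonds between macrotiles. -/

namespace MacroTile

open Assembly Encodable

variable {n τ : ℕ} {i j i' j' : ℕ} {p q v : ℤ × ℤ} {s t t' : TileType} {α β : Assembly}

/-- The macrotile and the cell within it that a lattice point belongs to. -/
noncomputable def locate (n : ℕ) (P : ℤ × ℤ) : (ℤ × ℤ) × ℕ × ℕ := (exists_pos n P).choose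

/-- The assembly in which each tile of `α` is replaced by its macrotile. -/
noncomputable def expand (n τ : ℕ) (α : Assembly) : Assembly := fun P =>
  (α (locate n P).1).map fun t => tile n τ t (locate n P).2.1 (locate n P).2.2

theorem locate_pos (h : Cell n i j) : locate n (pos n p i j) = (p, i, j) := by
  obtain ⟨h1, h2⟩ := (exists_pos n (pos n p i j)).choose_spec
  obtain ⟨e1, e2, e3⟩ := pos_inj h h1 h2
  exact Prod.ext e1.symm (Prod.ext e2.symm e3.symm)

theorem forall_pos {f : ℤ × ℤ → Prop} (h : ∀ p i j, Cell n i j → f (pos n p i j)) (P : ℤ × ℤ) :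
    f P := by
  obtain ⟨q, h1, rfl⟩ := exists_pos n P
  exact h _ _ _ h1

theorem expand_pos (h : Cell n i j) :
    expand n τ α (pos n p i j) = (α p).map fun t => tile n τ t i j := by
  simp [expand, locate_pos h]

theorem pos_mem_dom_expand (h : Cell n i j) : pos n p i j ∈ (expand n τ α).dom ↔ p ∈ α.dom := by
  simp [dom, expand_pos h]

theorem cell_one_one : Cell n 1 1 := Or.inl (by omega)

/-- The translation of macrotile assemblies that corresponds to the translation by `v`. -/
def shift (n : ℕ) (v : ℤ × ℤ) : ℤ × ℤ := (side n * v.1, side n * v.2)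

theorem pos_sub_shift : pos n p i j - shift n v = pos n (p - v) i j := by
  simp only [pos, shift, Prod.ext_iff, Prod.fst_sub, Prod.snd_sub]
  constructor <;> ring

theorem expand_translate : expand n τ (α.translate v) = (expand n τ α).translate (shift n v) := by
  funext P
  induction P using forall_pos (n := n) with
  | h p i j h =>
    rw [Assembly.translate, pos_sub_shift, expand_pos h, expand_pos h, Assembly.translate]

theorem expand_union : expand n τ (α.union β) = (expand n τ α).union (expand n τ β) := by
  funext P
  simp only [expand, union]
  cases α (locate n P).1 <;> simp

theorem disjoint_expand :
    Disjoint (expand n τ α).dom (expand n τ β).dom ↔ Disjoint α.dom β.dom := by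
  simp only [Set.disjoint_left]
  constructor
  · intro h p hp
    have := h ((pos_mem_dom_expand cell_one_one).2 hp)
    rwa [pos_mem_dom_expand cell_one_one] at this
  · intro h P
    induction P using forall_pos (n := n) with
    | h p i j hc =>
      rw [pos_mem_dom_expand hc, pos_mem_dom_expand hc]
      exact @h p

theorem dom_expand_nonempty (h : α.dom.Nonempty) : (expand n τ α).dom.Nonempty := by
  obtain ⟨p, hp⟩ := h
  exact ⟨_, (pos_mem_dom_expand cell_one_one).2 hp⟩

/-- All tiles of `α` have codes that fit into macrotiles of size `n`. -/
def AllFit (n : ℕ) (α : Assembly) : Prop := ∀ p t, α p = some t → Fits n t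

theorem AllFit.translate (h : AllFit n α) (v : ℤ × ℤ) : AllFit n (α.translate v) :=
  fun _ _ hp => h _ _ hp

/-- The two cells at which the macrotiles of neighbouring tiles of `α` at `p` and `q` that are
bonded touch. -/
def link (n : ℕ) (α : Assembly) (p q : ℤ × ℤ) : (ℤ × ℤ) × (ℤ × ℤ) :=
  -- The default is read only if `p` is unoccupied, in which case there is no bond.
  let c := portCell n ((α p).getD default) (q - p)
  (pos n p c.1 c.2, pos n p c.1 c.2 + (q - p))

theorem expand_eq_some_pos (h : Cell n i j) (hs : expand n τ α (pos n p i j) = some s) :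
    ∃ t, α p = some t ∧ s = tile n τ t i j := by
  rw [expand_pos h, Option.map_eq_some_iff] at hs
  obtain ⟨t, h1, h2⟩ := hs
  exact ⟨t, h1, h2.symm⟩

/-- If two macrotile assemblies that do not overlap are bonded somewhere, then their relative
offset is that of two aligned neighbouring macrotiles. -/
theorem touch_assemblies {w w' P Q : ℤ × ℤ} (hα : AllFit n α) (hβ : AllFit n β)
    (h : Cell n i j) (h' : Cell n i' j')
    (hd : ∀ i j i' j' : ℕ, Cell n i j → Cell n i' j' → pos n p i j + w ≠ pos n q i' j' + w')
    (ht : α p = some t) (ht' : β q = some t') (hP : P = pos n p i j + w)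
    (hQ : Q = pos n q i' j' + w')
    (hg : (tile n τ t i j).glue (Q - P) = (tile n τ t' i' j').glue (P - Q))
    (hs : 0 < ((tile n τ t i j).glue (Q - P)).2) :
    shift n q + w' = shift n p + w + shift n (Q - P) ∧ (i, j) = portCell n t (Q - P) ∧
      t.glue (Q - P) = t'.glue (P - Q) ∧
      ((tile n τ t i j).glue (Q - P)).2 = min (t.glue (Q - P)).2 τ := by
  have e : P - Q = -(Q - P) := by abel
  rw [e] at hg ⊢
  have key := touch (u := shift n p + w) (u' := shift n q + w') (hα _ _ ht) (hβ _ _ ht') h h'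
    (fun i j i' j' hc hc' he => hd i j i' j' hc hc' (by
      simp only [pos, shift, Prod.ext_iff, Prod.fst_add, Prod.snd_add] at he ⊢
      constructor <;> linarith))
    (by simp only [hP, hQ, pos, shift, Prod.fst_add, Prod.fst_sub]; ring)
    (by simp only [hP, hQ, pos, shift, Prod.snd_add, Prod.snd_sub]; ring) hg hs
  refine ⟨?_, key.2⟩
  rw [key.1]
  simp [shift, side, Prod.ext_iff]

/-- A bond between distinct macrotiles sits at a port, and alignment shows that the macrotiles are
neighbours in the direction of the bond. So the pair `p`, `q` determines the bond. -/
theorem eq_link (hα : AllFit n α) (hpq : p ≠ q) (h : Cell n i j) (h' : Cell n i' j')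
    (hb : 0 < (expand n τ α).bond (pos n p i j) (pos n q i' j')) :
    (pos n p i j, pos n q i' j') = link n α p q ∧
      (expand n τ α).bond (pos n p i j) (pos n q i' j') = min (α.bond p q) τ := by
  obtain ⟨s, s', hs, hs', hg, hbe⟩ := exists_of_bond_pos hb
  obtain ⟨t, ht, rfl⟩ := expand_eq_some_pos h hs
  obtain ⟨t', ht', rfl⟩ := expand_eq_some_pos h' hs'
  rw [hbe] at hb ⊢
  obtain ⟨e1, e2, e3, e4⟩ := touch_assemblies (w := 0) (w' := 0) hα hα h h'
    (fun i j i' j' hc hc' he => hpq (pos_inj hc hc' (by simpa using he)).1) ht ht'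
    (add_zero _).symm (add_zero _).symm hg hb
  have e5 : q - p = pos n q i' j' - pos n p i j := by
    -- In `e1` both indices and the contact direction are scaled by the side length, which cancels.
    generalize pos n q i' j' - pos n p i j = d at e1
    have hm : (side n : ℤ) ≠ 0 := by simp [side]; omega
    simp only [shift, Prod.ext_iff, Prod.fst_add, Prod.snd_add, add_zero,
      ← mul_add] at e1
    have e6 := mul_left_cancel₀ hm e1.1
    have e7 := mul_left_cancel₀ hm e1.2
    ext <;> simp [e6, e7]
  have e6 : p - q = pos n p i j - pos n q i' j' := by
    rw [← neg_sub, e5, neg_sub]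
  rw [← e5, ← e6] at e3
  rw [← e5] at e2 e4
  rw [← e5]
  constructor
  · simp only [link, ht, Option.getD_some, ← e2]
    rw [e5, add_sub_cancel]
  · rw [e4, bond_eq_of_eq_some ht ht', if_pos e3]

theorem tile_port (ht : Fits n t) {d : ℤ × ℤ}
    (hd : d = (1, 0) ∨ d = (0, 1) ∨ d = (-1, 0) ∨ d = (0, -1)) :
    Cell n (portCell n t d).1 (portCell n t d).2 ∧
      (tile n τ t (portCell n t d).1 (portCell n t d).2).glue d =
        (port, min (t.glue d).2 τ) := by
  obtain ⟨-, h1, h2, h3, h4⟩ := ht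
  rcases hd with rfl | rfl | rfl | rfl
  · simp only [glue_east, portCell, tile, hglue, Cell]
    simp
    omega
  · simp only [glue_north, portCell, tile, vglue, Cell]
    simp
    omega
  · simp only [glue_west, portCell, tile, hglue, Cell]
    simp
    omega
  · simp only [glue_south, portCell, tile, vglue, Cell]
    simp
    omega

/-- Ports of equal abutting glues face each other, since the place of a port along its side depends
only on the code of the glue. -/
theorem pos_portCell_add {d : ℤ × ℤ}
    (hd : d = (1, 0) ∨ d = (0, 1) ∨ d = (-1, 0) ∨ d = (0, -1)) (hg : t.glue d = t'.glue (-d)) :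
    pos n p (portCell n t d).1 (portCell n t d).2 + d =
      pos n (p + d) (portCell n t' (-d)).1 (portCell n t' (-d)).2 := by
  rcases hd with rfl | rfl | rfl | rfl
  · rw [show -((1 : ℤ), (0 : ℤ)) = (-1, 0) from rfl, glue_east, glue_west] at *
    simp [portCell, pos, side, hg]
    ring
  · rw [show -((0 : ℤ), (1 : ℤ)) = (0, -1) from rfl, glue_north, glue_south] at *
    simp [portCell, pos, side, hg]
    ring
  · rw [show -((-1 : ℤ), (0 : ℤ)) = (1, 0) from rfl, glue_east, glue_west] at *
    simp [portCell, pos, side, hg]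
    ring
  · rw [show -((0 : ℤ), (-1 : ℤ)) = (0, 1) from rfl, glue_north, glue_south] at *
    simp [portCell, pos, side, hg]
    ring

/-- Converse to `eq_link`: each positive bond of `α` reappears, truncated at `τ`, at the two facing
ports. -/
theorem bond_link (hα : AllFit n α) (hb : 0 < α.bond p q) :
    ∃ i j i' j', Cell n i j ∧ Cell n i' j' ∧ link n α p q = (pos n p i j, pos n q i' j') ∧
      (expand n τ α).bond (pos n p i j) (pos n q i' j') = min (α.bond p q) τ := by
  obtain ⟨t, t', ht, ht', hg, hbe⟩ := exists_of_bond_pos hb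
  rw [hbe] at hb ⊢
  have hd := unit_of_glue_pos hb
  rw [← neg_sub q p] at hg
  have hd' : -(q - p) = (1, 0) ∨ -(q - p) = (0, 1) ∨ -(q - p) = (-1, 0) ∨ -(q - p) = (0, -1) := by
    rcases hd with h | h | h | h <;> rw [h] <;> simp
  obtain ⟨c, g⟩ := tile_port (τ := τ) (hα _ _ ht) hd
  obtain ⟨c', g'⟩ := tile_port (τ := τ) (hα _ _ ht') hd'
  have e := pos_portCell_add (n := n) (p := p) hd hg
  rw [add_sub_cancel] at e
  refine ⟨_, _, _, _, c, c', by simp only [link, ht, Option.getD_some, e], ?_⟩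
  have e1 : ∀ {P Q d : ℤ × ℤ}, P + d = Q → Q - P = d ∧ P - Q = -d := by
    rintro P _ d rfl; constructor <;> abel
  obtain ⟨e2, e3⟩ := e1 e
  rw [bond_eq_of_eq_some (by rw [expand_pos c, ht]; rfl) (by rw [expand_pos c', ht']; rfl),
    e2, e3, g, g', hg, if_pos rfl]

theorem bond_east (hp : p ∈ α.dom) (h : Cell n i j) (h' : Cell n (i + 1) j) :
    (expand n τ α).bond (pos n p i j) (pos n p (i + 1) j) = τ := by
  obtain ⟨t, ht⟩ := mem_dom.1 hp
  rw [bond_eq_of_eq_some (by rw [expand_pos h, ht]; rfl) (by rw [expand_pos h', ht]; rfl),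
    show pos n p (i + 1) j - pos n p i j = (1, 0) by simp [pos],
    show pos n p i j - pos n p (i + 1) j = (-1, 0) by simp [pos], glue_east, glue_west]
  simp [tile, hglue, h, h']

theorem bond_north (hp : p ∈ α.dom) (h : Cell n i j) (h' : Cell n i (j + 1)) :
    (expand n τ α).bond (pos n p i j) (pos n p i (j + 1)) = τ := by
  obtain ⟨t, ht⟩ := mem_dom.1 hp
  rw [bond_eq_of_eq_some (by rw [expand_pos h, ht]; rfl) (by rw [expand_pos h', ht]; rfl),
    show pos n p i (j + 1) - pos n p i j = (0, 1) by simp [pos],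
    show pos n p i j - pos n p i (j + 1) = (0, -1) by simp [pos], glue_north, glue_south]
  simp [tile, vglue, h, h']

/-- If some term reaches `τ`, it suffices alone; otherwise truncation changes nothing. -/
theorem le_sum_min {ι : Type*} {F : Finset ι} {f : ι → ℕ} (h : τ ≤ ∑ e ∈ F, f e) :
    τ ≤ ∑ e ∈ F, min (f e) τ := by
  by_cases hc : ∃ e ∈ F, τ ≤ f e
  · obtain ⟨e, he, hfe⟩ := hc
    calc τ = min (f e) τ := (min_eq_right hfe).symm
      _ ≤ _ := Finset.single_le_sum (f := fun e => min (f e) τ) (fun _ _ => Nat.zero_le _) he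
  · push Not at hc
    exact h.trans (Finset.sum_le_sum fun e he => by rw [min_eq_left (hc e he).le])

/-! ### Stability and alignment of expansions. -/

/-- A cut of `α` lifts to a cut along borders of macrotiles. Each positive bond across the lifted
cut is the `link` of its pair of macrotiles, so projection to pairs is injective and no weight is
lost. -/
theorem stable_of_stable_expand (hα : AllFit n α) (h : (expand n τ α).Stable τ) :
    α.Stable τ := by
  classical
  intro X hX hne hneq
  have key : ∀ P, P ∈ (expand n τ α).dom ↔ (locate n P).1 ∈ α.dom := fun P => by
    simp [dom, expand]
  obtain ⟨F, hF, hs⟩ := h {P | (locate n P).1 ∈ X} (fun P hP => (key P).2 (hX hP))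
    (by obtain ⟨x, hx⟩ := hne; exact ⟨pos n x 1 1, by simpa [locate_pos cell_one_one] using hx⟩)
    (fun he => hneq (by
      ext p
      have := Set.ext_iff.1 he (pos n p 1 1)
      rwa [key, Set.mem_ofPred_eq, locate_pos cell_one_one] at this))
  -- Edges without weight must be dropped, since several of them may lie between the same two
  -- macrotiles.
  have hlink : ∀ e ∈ F.filter fun e => 0 < (expand n τ α).bond e.1 e.2,
      e = link n α (locate n e.1).1 (locate n e.2).1 ∧
      (expand n τ α).bond e.1 e.2 = min (α.bond (locate n e.1).1 (locate n e.2).1) τ := by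
    rintro ⟨P, Q⟩ he
    obtain ⟨he, hb⟩ := Finset.mem_filter.1 he
    obtain ⟨h1, -, h2⟩ := hF _ he
    obtain ⟨⟨p, i, j⟩, hc, rfl⟩ := exists_pos n P
    obtain ⟨⟨q, i', j'⟩, hc', rfl⟩ := exists_pos n Q
    simp only [locate_pos hc, locate_pos hc', Set.mem_ofPred_eq] at h1 h2 hb ⊢
    exact eq_link hα (by rintro rfl; exact h2 h1) hc hc' hb
  refine ⟨(F.filter fun e => 0 < (expand n τ α).bond e.1 e.2).image
    fun e => ((locate n e.1).1, (locate n e.2).1), ?_, ?_⟩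
  · intro e he
    obtain ⟨e', he', rfl⟩ := Finset.mem_image.1 he
    obtain ⟨h1, h2, h3⟩ := hF _ (Finset.mem_filter.1 he').1
    exact ⟨h1, (key _).1 h2, h3⟩
  · rw [Finset.sum_image]
    · calc τ ≤ ∑ e ∈ F, (expand n τ α).bond e.1 e.2 := hs
        _ = ∑ e ∈ F.filter fun e => 0 < (expand n τ α).bond e.1 e.2,
              (expand n τ α).bond e.1 e.2 := by
          rw [Finset.sum_filter]
          refine Finset.sum_congr rfl fun e _ => ?_
          split_ifs with h
          · rfl
          · omega
        _ ≤ _ := Finset.sum_le_sum fun e he => by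
          rw [(hlink e he).2]; exact min_le_left _ _
    · intro e he e' he' hee
      simp only [Prod.mk.injEq] at hee
      rw [(hlink e he).1, (hlink e' he').1, hee.1, hee.2]

/-- Either the cut separates two bonded cells of one macrotile, and this single bond has strength
`τ`, or it is a union of macrotiles and comes from a cut of `α`, whose weight survives truncation by
`le_sum_min`. -/
theorem stable_expand_of_stable (hα : AllFit n α) (h : α.Stable τ) :
    (expand n τ α).Stable τ := by
  classical
  intro X hX hne hneq
  by_cases hsplit : ∃ P Q, P ∈ X ∧ Q ∈ (expand n τ α).dom \ X ∧
      (expand n τ α).bond P Q = τ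
  · obtain ⟨P, Q, hP, hQ, hb⟩ := hsplit
    exact ⟨{(P, Q)}, by simpa using ⟨hP, hQ⟩, by simp [hb]⟩
  have hconn : ∀ p ∈ α.dom, ∀ i j, Cell n i j → (pos n p i j ∈ X ↔ pos n p 1 1 ∈ X) := by
    intro p hp i j hc
    have aux : ∀ i j i' j', Cell n i j → Cell n i' j' →
        (expand n τ α).bond (pos n p i j) (pos n p i' j') = τ →
        (pos n p i j ∈ X ↔ pos n p i' j' ∈ X) := by
      intro i j i' j' h h' hb
      constructor <;> intro hX <;> by_contra hX'
      · exact hsplit ⟨_, _, hX, ⟨(pos_mem_dom_expand h').2 hp, hX'⟩, hb⟩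
      · exact hsplit ⟨_, _, hX, ⟨(pos_mem_dom_expand h).2 hp, hX'⟩, by rwa [bond_comm]⟩
    exact cell_connected (f := fun i j => pos n p i j ∈ X)
      (fun i j h h' => aux _ _ _ _ h h' (bond_east hp h h'))
      (fun i j h h' => aux _ _ _ _ h h' (bond_north hp h h')) hc
  have hX' : ∀ p i j, Cell n i j → (pos n p i j ∈ X ↔ pos n p 1 1 ∈ X) := by
    intro p i j hc
    by_cases hp : p ∈ α.dom
    · exact hconn p hp i j hc
    · refine iff_of_false (fun h => hp ?_) (fun h => hp ?_)
      · exact (pos_mem_dom_expand hc).1 (hX h)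
      · exact (pos_mem_dom_expand cell_one_one).1 (hX h)
  -- The cell `(1, 1)` decides on which side of the cut its macrotile lies.
  obtain ⟨F, hF, hs⟩ := h {p | pos n p 1 1 ∈ X}
    (fun p hp => (pos_mem_dom_expand cell_one_one).1 (hX hp))
    (by
      obtain ⟨P, hP⟩ := hne
      obtain ⟨⟨p, i, j⟩, hc, rfl⟩ := exists_pos n P
      exact ⟨p, (hX' p i j hc).1 hP⟩)
    (fun he => hneq (by
      ext P
      induction P using forall_pos (n := n) with
      | h p i j hc =>
        rw [hX' p i j hc, pos_mem_dom_expand hc]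
        exact Set.ext_iff.1 he p))
  have hlink : ∀ e ∈ F.filter fun e => 0 < α.bond e.1 e.2,
      (locate n (link n α e.1 e.2).1).1 = e.1 ∧ (locate n (link n α e.1 e.2).2).1 = e.2 ∧
      (link n α e.1 e.2).1 ∈ X ∧ (link n α e.1 e.2).2 ∈ (expand n τ α).dom \ X ∧
      (expand n τ α).bond (link n α e.1 e.2).1 (link n α e.1 e.2).2 = min (α.bond e.1 e.2) τ := by
    rintro ⟨p, q⟩ he
    obtain ⟨he, hb⟩ := Finset.mem_filter.1 he
    obtain ⟨h1, h2, h3⟩ := hF _ he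
    obtain ⟨i, j, i', j', hc, hc', e1, e2⟩ := bond_link (τ := τ) hα hb
    simp only at e1 h1 h2 h3 ⊢
    rw [e1]
    refine ⟨by rw [locate_pos hc], by rw [locate_pos hc'], (hX' _ _ _ hc).2 h1,
      ⟨(pos_mem_dom_expand hc').2 h2, fun h => h3 ((hX' _ _ _ hc').1 h)⟩, e2⟩
  refine ⟨(F.filter fun e => 0 < α.bond e.1 e.2).image fun e => link n α e.1 e.2, ?_, ?_⟩
  · intro e he
    obtain ⟨e', he', rfl⟩ := Finset.mem_image.1 he
    obtain ⟨-, -, h3, h4, -⟩ := hlink e' he'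
    exact ⟨h3, h4⟩
  · rw [Finset.sum_image]
    · calc τ ≤ ∑ e ∈ F, min (α.bond e.1 e.2) τ := le_sum_min hs
        _ = ∑ e ∈ F.filter fun e => 0 < α.bond e.1 e.2, min (α.bond e.1 e.2) τ := by
          rw [Finset.sum_filter]
          refine Finset.sum_congr rfl fun e _ => ?_
          split_ifs with h
          · rfl
          · simp; omega
        _ ≤ _ := Finset.sum_le_sum fun e he => (hlink e he).2.2.2.2.ge
    · intro e he e' he' hee
      obtain ⟨h1, h2, -⟩ := hlink e he
      obtain ⟨h1', h2', -⟩ := hlink e' he'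
      simp only at hee
      exact Prod.ext (by rw [← h1, ← h1', hee]) (by rw [← h2, ← h2', hee])

theorem stable_expand (hα : AllFit n α) : (expand n τ α).Stable τ ↔ α.Stable τ :=
  ⟨stable_of_stable_expand hα, stable_expand_of_stable hα⟩

/-- If translates of two macrotile assemblies combine stably, then they are aligned. -/
theorem aligned_of_stable (hτ : 0 < τ) (hα : AllFit n α) (hβ : AllFit n β)
    (hα' : α.dom.Nonempty) (hβ' : β.dom.Nonempty) {w w' : ℤ × ℤ}
    (hd : Disjoint ((expand n τ α).translate w).dom ((expand n τ β).translate w').dom)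
    (hs : (((expand n τ α).translate w).union ((expand n τ β).translate w')).Stable τ) :
    ∃ v, w' = w + shift n v := by
  obtain ⟨F, hF, hFs⟩ := hs.exists_cross hd (dom_translate_nonempty (dom_expand_nonempty hα'))
    (dom_translate_nonempty (dom_expand_nonempty hβ'))
  -- As `τ` is positive, at least one bond joins the two parts; one contact already fixes the
  -- offset.
  obtain ⟨⟨P, Q⟩, he, hb⟩ := Finset.exists_ne_zero_of_sum_ne_zero (by omega :
    ∑ e ∈ F, (((expand n τ α).translate w).union ((expand n τ β).translate w')).bond e.1 e.2 ≠ 0)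
  obtain ⟨hP, hQ⟩ := hF _ he
  obtain ⟨s, s', h1, h2, hg, hbe⟩ := exists_of_bond_pos (Nat.pos_of_ne_zero hb)
  simp only at hP hQ h1 h2 hg hbe hb
  rw [union_left hP] at h1
  rw [union_right hd hQ] at h2
  obtain ⟨⟨p, i, j⟩, hc, hp⟩ := exists_pos n (P - w)
  obtain ⟨⟨q, i', j'⟩, hc', hq⟩ := exists_pos n (Q - w')
  simp only [Assembly.translate] at h1 h2
  rw [hp] at h1
  rw [hq] at h2
  obtain ⟨t, ht, rfl⟩ := expand_eq_some_pos hc h1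
  obtain ⟨t', ht', rfl⟩ := expand_eq_some_pos hc' h2
  obtain ⟨e, -⟩ := touch_assemblies hα hβ hc hc' (fun i j i' j' hc hc' he => by
      refine Set.disjoint_left.1 hd (?_ : pos n p i j + w ∈ _) ?_
      · rw [mem_dom_translate, add_sub_cancel_right, pos_mem_dom_expand hc]
        exact mem_dom.2 ⟨t, ht⟩
      · rw [he, mem_dom_translate, add_sub_cancel_right, pos_mem_dom_expand hc']
        exact mem_dom.2 ⟨t', ht'⟩) ht ht' (sub_eq_iff_eq_add.1 hp) (sub_eq_iff_eq_add.1 hq) hg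
    (by rw [← hbe]; exact Nat.pos_of_ne_zero hb)
  -- The alignment equation `e` of the contact, solved for `w'`.
  refine ⟨p - q + (Q - P), ?_⟩
  have : shift n (p - q + (Q - P)) = shift n p - shift n q + shift n (Q - P) := by
    simp only [shift, Prod.ext_iff, Prod.fst_add, Prod.snd_add, Prod.fst_sub, Prod.snd_sub]
    constructor <;> ring
  rw [this, eq_sub_of_add_eq' e]
  abel

end MacroTile

namespace MacroTile

open Assembly Encodable

variable {n τ : ℕ} {i j : ℕ} {p q : ℤ × ℤ} {t : TileType} {α : Assembly}

/-! ### Reading the represented tile off a block -/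

/-- The label of the north glue of a possibly empty cell. -/
def northLabel (o : Option TileType) : List Bool := (o.map fun t => t.1.1).getD []

/-- The label of the north glue at the cell `(i, j)` of a block. -/
def blockLabel (b : Block) (i j : ℕ) : List Bool :=
  northLabel ((b.getD j []).getD i none)

/-- The block `b` contains the centre and one of the marks of a macrotile of `t`. -/
def Shows (n : ℕ) (b : Block) (t : TileType) : Prop :=
  ∃ i < side n, ∃ j < side n,
    (blockLabel b i j = centre ∧ blockLabel b (i + encode t + 1) j = mark) ∨
      (blockLabel b i j = mark ∧ blockLabel b (i + encode t + 1) j = centre)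

instance : DecidableRel (Shows n) := fun b t => by unfold Shows; infer_instance

/-- The representation function: the first tile of `l` that the block shows. -/
def represent (n : ℕ) (l : List TileType) (b : Block) : Option TileType :=
  l.find? fun t => decide (Shows n b t)

theorem flatMap_singleton_eq_map {ι κ : Type*} (f : ι → κ) (l : List ι) :
    (l.flatMap fun a => [f a]) = l.map f := by
  induction l with
  | nil => rfl
  | cons a l ih => simp [ih]

/-- Positions outside the block yield the empty label, which is neither centre nor mark. -/
theorem blockLabel_block (A : Assembly) (x y : ℤ) : blockLabel (A.block (side n) x y) i j =
    if i < side n ∧ j < side n then northLabel (A (side n * x + i, side n * y + j)) else [] := by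
  unfold blockLabel Assembly.block
  by_cases hj : j < side n
  · by_cases hi : i < side n
    · simp [hi, hj, List.getD_eq_getElem?_getD, flatMap_singleton_eq_map]
    · simp [hi, hj, List.getD_eq_getElem?_getD, northLabel]
  · simp [hj, List.getD_eq_getElem?_getD, northLabel]

/-- Bonds are labelled at their upper cell, here in row `2`, but are read as north glues, hence row
`1`. -/
theorem northLabel_tile : northLabel (some (tile n τ t i j)) = centre ↔
    Cell n i j ∧ j = 1 ∧ i = n + 2 := by
  change (vglue n τ t i (j + 1)).1 = centre ↔ _
  rw [vglue]
  by_cases hc : 1 ≤ j + 1 ∧ Cell n i (j + 1 - 1) ∧ Cell n i (j + 1)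
  · have hc' : Cell n i j := hc.2.1
    rw [if_pos hc, label]
    split_ifs with h1 h2
    · exact iff_of_true rfl ⟨hc', by omega⟩
    · exact iff_of_false (by simp [mark, centre]) (by omega)
    · exact iff_of_false (by simp [plain, centre]) (by omega)
  · rw [if_neg hc]
    refine iff_of_false ?_ ?_
    · split_ifs <;> simp [port, centre]
    · rintro ⟨h1, rfl, rfl⟩
      exact hc ⟨by omega, h1, Or.inl (by omega)⟩

theorem northLabel_tile' (ht : Fits n t) : northLabel (some (tile n τ t i j)) = mark ↔
    Cell n i j ∧ j = 1 ∧ (i + encode t + 1 = n + 2 ∨ i = n + 2 + encode t + 1) := by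
  have hle := ht.1
  change (vglue n τ t i (j + 1)).1 = mark ↔ _
  rw [vglue]
  by_cases hc : 1 ≤ j + 1 ∧ Cell n i (j + 1 - 1) ∧ Cell n i (j + 1)
  · have hc' : Cell n i j := hc.2.1
    rw [if_pos hc, label]
    split_ifs with h1 h2
    · exact iff_of_false (by simp [mark, centre]) (by omega)
    · exact iff_of_true rfl ⟨hc', by omega⟩
    · exact iff_of_false (by simp [plain, mark]) (by omega)
  · rw [if_neg hc]
    refine iff_of_false ?_ ?_
    · split_ifs <;> simp [port, mark]
    · rintro ⟨h1, rfl, h2⟩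
      exact hc ⟨by omega, h1, Or.inl (by omega)⟩

theorem northLabel_expand_centre (h : Cell n i j) :
    northLabel (expand n τ α (pos n p i j)) = centre ↔ p ∈ α.dom ∧ j = 1 ∧ i = n + 2 := by
  rw [expand_pos h, mem_dom]
  cases hp : α p with
  | none => simp [northLabel, centre]
  | some t => simp [northLabel_tile, h]

theorem northLabel_expand_mark (hα : AllFit n α) (h : Cell n i j) :
    northLabel (expand n τ α (pos n p i j)) = mark ↔ ∃ t, α p = some t ∧ j = 1 ∧
      (i + encode t + 1 = n + 2 ∨ i = n + 2 + encode t + 1) := by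
  rw [expand_pos h]
  cases hp : α p with
  | none => simp [northLabel, mark]
  | some t => simp [northLabel_tile' (hα _ _ hp), h]

theorem exists_of_northLabel_expand_centre {P : ℤ × ℤ}
    (h : northLabel (expand n τ α P) = centre) : ∃ p, P = pos n p (n + 2) 1 := by
  obtain ⟨⟨p, i, j⟩, hc, rfl⟩ := exists_pos n P
  obtain ⟨-, rfl, rfl⟩ := (northLabel_expand_centre hc).1 h
  exact ⟨p, rfl⟩

/-- The displacement of the represented assembly for a macrotile assembly translated by `w`. -/
def offset (n : ℕ) (w : ℤ × ℤ) : ℤ × ℤ := ((w.1 + n + 2) / side n, (w.2 + 1) / side n)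

/-- The block containing the translated centre of a macrotile is found by floor division; `offset`
is the resulting index difference. -/
theorem eq_sub_offset {w : ℤ × ℤ} (hi : i < side n) (hj : j < side n)
    (h1 : side n * q.1 + i - w.1 = side n * p.1 + (n + 2))
    (h2 : side n * q.2 + j - w.2 = side n * p.2 + 1) : p = q - offset n w := by
  have e1 : (w.1 + n + 2) = i + side n * (q.1 - p.1) := by linear_combination -h1
  have e2 : (w.2 + 1) = j + side n * (q.2 - p.2) := by linear_combination -h2
  have hm : (side n : ℤ) ≠ 0 := by simp [side]; omega
  unfold offset
  rw [e1, e2, Int.add_mul_ediv_left _ _ hm, Int.add_mul_ediv_left _ _ hm,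
    Int.ediv_eq_zero_of_lt (by omega) (by omega), Int.ediv_eq_zero_of_lt (by omega) (by omega)]
  ext <;> simp

/-- Since `encode t ≤ n`, the columns at distance `encode t + 1` from a centre belong to the same
macrotile. A mark seen there is therefore a mark of that macrotile, and its distance yields the
tile. Conversely, the block around the centre contains one of the two marks. -/
theorem shows_iff (hα : AllFit n α) (ht : Fits n t) (w : ℤ × ℤ) :
    Shows n (((expand n τ α).translate w).block (side n) q.1 q.2) t ↔
      α (q - offset n w) = some t := by
  obtain ⟨w₁, w₂⟩ := w
  have hle := ht.1
  have hcc : Cell n (n + 2) 1 := Or.inl (by omega)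
  have hcr : Cell n (n + 2 + encode t + 1) 1 := Or.inl (by omega)
  have hcl : Cell n (n + 1 - encode t) 1 := Or.inl (by omega)
  simp only [Shows, blockLabel_block, Assembly.translate, Prod.mk_sub_mk]
  constructor
  · rintro ⟨i, hi, j, hj, ⟨h1, h2⟩ | ⟨h1, h2⟩⟩
    · rw [if_pos ⟨hi, hj⟩] at h1
      split_ifs at h2 with hi'
      · obtain ⟨p, hp⟩ := exists_of_northLabel_expand_centre h1
        obtain ⟨e1, e2⟩ := pos_ext.1 hp
        dsimp only at e1 e2
        rw [← eq_sub_offset (w := (w₁, w₂)) (p := p) hi hj (by simpa [side] using e1)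
          (by simpa [side] using e2)]
        rw [show (side n * q.1 + ((i + encode t + 1 : ℕ) : ℤ) - w₁, side n * q.2 + (j : ℤ) - w₂)
          = pos n p (n + 2 + encode t + 1) 1 from
            pos_ext.2 ⟨by simp only [side] at *; push_cast at e1 ⊢; linarith, e2⟩,
          northLabel_expand_mark hα hcr] at h2
        obtain ⟨t', ht', -, h3⟩ := h2
        rw [ht', encode_injective (show encode t' = encode t by omega)]
      · simp [mark] at h2
    · rw [if_pos ⟨hi, hj⟩] at h1
      split_ifs at h2 with hi'
      · obtain ⟨p, hp⟩ := exists_of_northLabel_expand_centre h2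
        obtain ⟨e1, e2⟩ := pos_ext.1 hp
        dsimp only at e1 e2
        rw [← eq_sub_offset (w := (w₁, w₂)) (p := p) hi'.1 hj (by simpa [side] using e1)
          (by simpa [side] using e2)]
        rw [show (side n * q.1 + (i : ℤ) - w₁, side n * q.2 + (j : ℤ) - w₂)
          = pos n p (n + 1 - encode t) 1 from
            pos_ext.2 ⟨by simp only [side] at *; push_cast [Nat.cast_sub (show encode t ≤ n + 1 by omega)] at e1 ⊢
                          linarith, e2⟩,
          northLabel_expand_mark hα hcl] at h1
        obtain ⟨t', ht', -, h3⟩ := h1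
        rw [ht', encode_injective (show encode t' = encode t by omega)]
      · simp [centre] at h2
  · intro h
    have hm : (0 : ℤ) < side n := by simp [side]; omega
    have hdom : q - offset n (w₁, w₂) ∈ α.dom := mem_dom.2 ⟨t, h⟩
    have hx := Int.mul_ediv_add_emod (w₁ + n + 2) (side n)
    have hy := Int.mul_ediv_add_emod (w₂ + 1) (side n)
    have hx1 := Int.emod_lt_of_pos (w₁ + n + 2) hm
    have hy1 := Int.emod_lt_of_pos (w₂ + 1) hm
    have hx0 := Int.emod_nonneg (w₁ + n + 2) hm.ne'
    have hy0 := Int.emod_nonneg (w₂ + 1) hm.ne'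
    set p := q - offset n (w₁, w₂) with hp
    have hq : q = p + offset n (w₁, w₂) := by rw [hp]; abel
    have hq1 : q.1 = p.1 + (w₁ + n + 2) / side n := by rw [hq]; rfl
    have hq2 : q.2 = p.2 + (w₂ + 1) / side n := by rw [hq]; rfl
    lift (w₁ + n + 2) % side n to ℕ using hx0 with r hr
    lift (w₂ + 1) % side n to ℕ using hy0 with s hs
    have hr' : r < side n := by exact_mod_cast hx1
    have hs' : s < side n := by exact_mod_cast hy1
    have ey : side n * q.2 + (s : ℤ) - w₂ = side n * p.2 + 1 := by
      rw [hq2]; linear_combination hy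
    -- Here `r` is the column of the centre in the block. If the right mark falls outside, then `r`
    -- is large enough for the left mark to lie inside.
    by_cases hc : r + encode t + 1 < side n
    · refine ⟨r, hr', s, hs', Or.inl ⟨?_, ?_⟩⟩
      · rw [if_pos ⟨hr', hs'⟩, show (side n * q.1 + (r : ℤ) - w₁, side n * q.2 + (s : ℤ) - w₂) =
          pos n p (n + 2) 1 from Prod.ext (by
            simp only [pos]; rw [hq1]; push_cast; linear_combination hx) (by simpa [pos] using ey),
          northLabel_expand_centre hcc]
        exact ⟨hdom, rfl, rfl⟩
      · rw [if_pos ⟨hc, hs'⟩, show (side n * q.1 + ((r + encode t + 1 : ℕ) : ℤ) - w₁,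
          side n * q.2 + (s : ℤ) - w₂) = pos n p (n + 2 + encode t + 1) 1 from Prod.ext (by
            simp only [pos]; rw [hq1]; push_cast; linear_combination hx) (by simpa [pos] using ey),
          northLabel_expand_mark hα hcr]
        exact ⟨t, h, rfl, Or.inr rfl⟩
    · have hc' : encode t + 1 ≤ r := by unfold side at hc; omega
      refine ⟨r - (encode t + 1), by omega, s, hs', Or.inr ⟨?_, ?_⟩⟩
      · rw [if_pos ⟨by omega, hs'⟩, show (side n * q.1 + ((r - (encode t + 1) : ℕ) : ℤ) - w₁,
          side n * q.2 + (s : ℤ) - w₂) = pos n p (n + 1 - encode t) 1 from Prod.ext (by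
            simp only [pos]
            rw [hq1, Nat.cast_sub hc', Nat.cast_sub (show encode t ≤ n + 1 by omega)]
            push_cast; linear_combination hx) (by simpa [pos] using ey),
          northLabel_expand_mark hα hcl]
        exact ⟨t, h, rfl, Or.inl (by omega)⟩
      · rw [if_pos ⟨by omega, hs'⟩, show (side n * q.1 +
          ((r - (encode t + 1) + encode t + 1 : ℕ) : ℤ) - w₁, side n * q.2 + (s : ℤ) - w₂) =
          pos n p (n + 2) 1 from Prod.ext (by
            simp only [pos]
            rw [hq1, show r - (encode t + 1) + encode t + 1 = r by omega]
            push_cast; linear_combination hx) (by simpa [pos] using ey),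
          northLabel_expand_centre hcc]
        exact ⟨hdom, rfl, rfl⟩

/-- A macrotile assembly represents the original assembly, whatever its alignment. -/
theorem repAssembly_expand {l : List TileType} (hl : ∀ t ∈ l, Fits n t)
    (hα : α.Over l.toFinset) (w : ℤ × ℤ) :
    repAssembly (side n) (represent n l) ((expand n τ α).translate w) =
      α.translate (offset n w) := by
  have hfit : AllFit n α := fun p t h => hl t (List.mem_toFinset.1 (hα p t h))
  funext q
  apply Option.ext
  intro t
  simp only [repAssembly, represent, Assembly.translate]
  have key : ∀ t ∈ l, Shows n (((expand n τ α).translate w).block (side n) q.1 q.2) t ↔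
      α (q - offset n w) = some t := fun t ht => shows_iff hfit (hl t ht) w
  constructor
  · intro h
    have h1 := List.find?_some h
    exact (key t (List.mem_of_find?_eq_some h)).1 (of_decide_eq_true h1)
  · intro h
    have htl : t ∈ l := List.mem_toFinset.1 (hα _ t h)
    -- The order of `l` is irrelevant: any tile that the block shows equals the tile of `α`.
    cases h1 : l.find? fun t => decide
        (Shows n (((expand n τ α).translate w).block (side n) q.1 q.2) t) with
    | none =>
      have := List.find?_eq_none.1 h1 t htl
      simp [(key t htl).2 h] at this
    | some t' =>
      have h3 := List.find?_some h1
      have h2 := (key t' (List.mem_of_find?_eq_some h1)).1 (of_decide_eq_true h3)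
      rw [← h2, h]

theorem offset_zero : offset n 0 = 0 := by
  simp only [offset, side, Prod.fst_zero, Prod.snd_zero]
  rw [Int.ediv_eq_zero_of_lt (by omega) (by push_cast; omega),
    Int.ediv_eq_zero_of_lt (by omega) (by push_cast; omega)]
  rfl

theorem repAssembly_expand_zero {l : List TileType} (hl : ∀ t ∈ l, Fits n t)
    (hα : α.Over l.toFinset) :
    repAssembly (side n) (represent n l) (expand n τ α) = α := by
  have := repAssembly_expand (τ := τ) hl hα 0
  rwa [offset_zero, translate_zero, translate_zero] at this

theorem offset_shift (v : ℤ × ℤ) : offset n (shift n v) = v := by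
  have hm : (side n : ℤ) ≠ 0 := by simp [side]; omega
  simp only [offset, shift]
  rw [add_assoc, add_comm, Int.add_mul_ediv_left _ _ hm, add_comm (_ * _),
    Int.add_mul_ediv_left _ _ hm, Int.ediv_eq_zero_of_lt (by omega) (by simp [side]; omega),
    Int.ediv_eq_zero_of_lt (by omega) (by simp [side]; omega)]
  simp

theorem repSupertile_expand {l : List TileType} (hl : ∀ t ∈ l, Fits n t)
    (hα : α.Over l.toFinset) :
    repSupertile (side n) (represent n l) (expand n τ α).supertile = α.supertile := by
  ext β
  constructor
  · rintro ⟨_, ⟨w, rfl⟩, rfl⟩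
    exact ⟨offset n w, (repAssembly_expand hl hα w).symm⟩
  · rintro ⟨v, rfl⟩
    refine ⟨_, ⟨shift n v, rfl⟩, ?_⟩
    rw [repAssembly_expand hl hα, offset_shift]

/-- In the standard alignment only the bumps leave the block of their macrotile, and they lie in its
eastern and northern neighbours. -/
theorem cleanTo_expand : CleanTo (side n) (expand n τ α) α := by
  refine Or.inl fun x y ⟨i, j, hi, hj, h⟩ => ?_
  unfold side at hi hj
  by_cases h1 : i = 0 ∧ j = n + 2
  · obtain ⟨rfl, rfl⟩ := h1
    rw [show ((side n : ℤ) * x + ((0 : ℕ) : ℤ), (side n : ℤ) * y + ((n + 2 : ℕ) : ℤ)) =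
      pos n (x - 1, y) (2 * n + 4) (n + 2) from
        Prod.ext (by simp [pos, side]; ring) (by simp [pos]),
      pos_mem_dom_expand (Or.inr (Or.inl ⟨rfl, rfl⟩))] at h
    exact ⟨-1, 0, by simp, by simp, by norm_num, by simpa [sub_eq_add_neg] using h⟩
  by_cases h2 : i = n + 2 ∧ j = 0
  · obtain ⟨rfl, rfl⟩ := h2
    rw [show ((side n : ℤ) * x + ((n + 2 : ℕ) : ℤ), (side n : ℤ) * y + ((0 : ℕ) : ℤ)) =
      pos n (x, y - 1) (n + 2) (2 * n + 4) from
        Prod.ext (by simp [pos]) (by simp [pos, side]; ring),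
      pos_mem_dom_expand (Or.inr (Or.inr ⟨rfl, rfl⟩))] at h
    exact ⟨0, -1, by simp, by simp, by norm_num, by simpa [sub_eq_add_neg] using h⟩
  · refine ⟨0, 0, by simp, by simp, by norm_num, ?_⟩
    simpa using (pos_mem_dom_expand (p := (x, y)) (Or.inl ⟨hi, hj, h1, h2⟩)).1 h

end MacroTile

namespace MacroTile

open Assembly Encodable

variable {n τ : ℕ} {i j : ℕ} {p q : ℤ × ℤ} {t : TileType} {α : Assembly}

/-! ### The initial state as a list, and computability -/

/-- The cells of a macrotile. -/
def cellList (n : ℕ) : List (ℕ × ℕ) :=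
  ((List.range (2 * n + 5)).flatMap fun i => (List.range (2 * n + 5)).map fun j => (i, j)).filter
    fun c => decide (Cell n c.1 c.2)

/-- The list of the tiles of the macrotiles of a finite assembly. -/
def expandList (n τ : ℕ) (l : FinAssembly) : FinAssembly :=
  l.flatMap fun e => (cellList n).map fun c => (pos n e.1 c.1 c.2, tile n τ e.2 c.1 c.2)

theorem mem_cellList {c : ℕ × ℕ} : c ∈ cellList n ↔ Cell n c.1 c.2 := by
  obtain ⟨i, j⟩ := c
  simp only [cellList, List.mem_filter, List.mem_flatMap, List.mem_map, List.mem_range,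
    Prod.mk.injEq, decide_eq_true_eq]
  constructor
  · exact fun h => h.2
  · intro h
    have : i < 2 * n + 5 ∧ j < 2 * n + 5 := by rcases h with h | h | h <;> omega
    exact ⟨⟨i, this.1, j, this.2, rfl, rfl⟩, h⟩

theorem lookup_map {ι κ ν : Type*} [BEq κ] [LawfulBEq κ] (f : ι → κ) (g : ι → ν) (L : List ι)
    {c : ι} (hc : c ∈ L) (hf : ∀ c' ∈ L, f c' = f c → c' = c) :
    (L.map fun c => (f c, g c)).lookup (f c) = some (g c) := by
  induction L with
  | nil => simp at hc
  | cons a L ih =>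
    rw [List.map_cons, List.lookup_cons]
    split
    · rename_i h
      rw [hf a (by simp) (eq_of_beq h).symm]
    · rename_i h
      refine ih ?_ fun c' h' => hf c' (by simp [h'])
      rcases List.mem_cons.1 hc with rfl | h'
      · simp at h
      · exact h'

theorem lookup_map_eq_none {ι κ ν : Type*} [BEq κ] [LawfulBEq κ] (f : ι → κ) (g : ι → ν)
    (L : List ι) {k : κ} (hk : ∀ c ∈ L, f c ≠ k) : (L.map fun c => (f c, g c)).lookup k = none := by
  rw [List.lookup_eq_none_iff]
  intro e he
  obtain ⟨c, hc, rfl⟩ := List.mem_map.1 he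
  simpa using (hk c hc).symm

/-- Entries for a cell of macrotile `p` come only from entries for `p`, in the same order, so the
first one counts on both sides even if the list repeats a point. -/
theorem toAssembly_expandList (l : FinAssembly) :
    FinAssembly.toAssembly (expandList n τ l) = expand n τ (FinAssembly.toAssembly l) := by
  funext P
  induction P using forall_pos (n := n) with
  | h p i j h =>
    rw [expand_pos h]
    unfold FinAssembly.toAssembly expandList
    induction l with
    | nil => rfl
    | cons e l ih =>
      rw [List.flatMap_cons, List.lookup_append, ih, List.lookup_cons]
      split
      · rename_i he
        obtain rfl := eq_of_beq he
        rw [lookup_map (fun c : ℕ × ℕ => pos n e.1 c.1 c.2) (fun c => tile n τ e.2 c.1 c.2)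
          (cellList n) (c := (i, j)) (mem_cellList.2 h)]
        · rfl
        · intro c hc heq
          obtain ⟨-, h1, h2⟩ := pos_inj (mem_cellList.1 hc) h heq
          exact Prod.ext h1 h2
      · rename_i he
        rw [lookup_map_eq_none (fun c : ℕ × ℕ => pos n e.1 c.1 c.2)
          (fun c => tile n τ e.2 c.1 c.2)]
        · rfl
        · intro c hc heq
          obtain ⟨h1, -, -⟩ := pos_inj (mem_cellList.1 hc) h heq
          simp [h1] at he

/-! ### Primitive recursiveness of the construction. -/

section Primrec

variable {σ : Type*} [Primcodable σ] {f g k : σ → ℕ}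

theorem primrec_add (hf : Primrec f) (hg : Primrec g) : Primrec fun a => f a + g a :=
  Primrec.nat_add.comp hf hg

theorem primrec_mul (hf : Primrec f) (hg : Primrec g) : Primrec fun a => f a * g a :=
  Primrec.nat_mul.comp hf hg

theorem primrec_side (hf : Primrec f) : Primrec fun a => 2 * f a + 4 :=
  primrec_add (primrec_mul (.const 2) hf) (.const 4)

theorem primrecPred_eq (hf : Primrec f) (hg : Primrec g) : PrimrecPred fun a => f a = g a :=
  Primrec.eq.comp hf hg

theorem primrecPred_lt (hf : Primrec f) (hg : Primrec g) : PrimrecPred fun a => f a < g a :=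
  Primrec.nat_lt.comp hf hg

theorem primrecPred_le (hf : Primrec f) (hg : Primrec g) : PrimrecPred fun a => f a ≤ g a :=
  Primrec.nat_le.comp hf hg

theorem primrecPred_cell (hn : Primrec k) (hf : Primrec f) (hg : Primrec g) :
    PrimrecPred fun a => Cell (k a) (f a) (g a) := by
  have h2 := primrec_add hn (.const 2)
  have h4 := primrec_side hn
  have h0 : Primrec fun _ : σ => 0 := .const 0
  exact ((primrecPred_lt hf h4).and ((primrecPred_lt hg h4).and
    (((primrecPred_eq hf h0).and (primrecPred_eq hg h2)).not.and
      ((primrecPred_eq hf h2).and (primrecPred_eq hg h0)).not))).or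
    (((primrecPred_eq hf h4).and (primrecPred_eq hg h2)).or
      ((primrecPred_eq hf h2).and (primrecPred_eq hg h4)))

variable {c r : σ → ℕ} {s : σ → TileType}

theorem primrec_label (hn : Primrec k) (hc : Primrec c) (hf : Primrec f) (hg : Primrec g) :
    Primrec fun a => label (k a) (c a) (f a) (g a) := by
  have h2 := primrec_add hn (.const 2)
  have h1 : Primrec fun _ : σ => 1 := .const 1
  have hg2 := primrecPred_eq hg (.const 2)
  exact .ite (hg2.and (primrecPred_eq hf h2)) (.const _)
    (.ite (hg2.and ((primrecPred_eq (primrec_add (primrec_add hf hc) h1) h2).or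
      (primrecPred_eq hf (primrec_add (primrec_add h2 hc) h1)))) (.const _) (.const _))

theorem primrec_port {x : σ → Glue} (hr : Primrec r) (hx : Primrec x) :
    Primrec fun a => (port, min (x a).2 (r a)) :=
  .pair (.const _) (Primrec.nat_min.comp (Primrec.snd.comp hx) hr)

theorem primrec_vglue (hn : Primrec k) (hr : Primrec r) (hs : Primrec s) (hf : Primrec f)
    (hg : Primrec g) : Primrec fun a => vglue (k a) (r a) (s a) (f a) (g a) := by
  have hN : Primrec fun a => (s a).1 := Primrec.fst.comp hs
  have hS : Primrec fun a => (s a).2.2.1 :=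
    Primrec.fst.comp (Primrec.snd.comp (Primrec.snd.comp hs))
  refine .ite (((primrecPred_le (.const 1) hg).and ((primrecPred_cell hn hf
    (Primrec.nat_sub.comp hg (.const 1))).and (primrecPred_cell hn hf hg))))
    (.pair (primrec_label hn (Primrec.encode.comp hs) hf hg) hr) (.ite
    ((primrecPred_eq hg (primrec_side hn)).and (primrecPred_eq hf (Primrec.encode.comp hN)))
    (primrec_port hr hN) (.ite
    ((primrecPred_eq hg (.const 0)).and (primrecPred_eq hf (Primrec.encode.comp hS)))
    (primrec_port hr hS) (.const _)))

theorem primrec_hglue (hn : Primrec k) (hr : Primrec r) (hs : Primrec s) (hf : Primrec f)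
    (hg : Primrec g) : Primrec fun a => hglue (k a) (r a) (s a) (f a) (g a) := by
  have hE : Primrec fun a => (s a).2.1 := Primrec.fst.comp (Primrec.snd.comp hs)
  have hW : Primrec fun a => (s a).2.2.2 :=
    Primrec.snd.comp (Primrec.snd.comp (Primrec.snd.comp hs))
  refine .ite (((primrecPred_le (.const 1) hf).and ((primrecPred_cell hn
    (Primrec.nat_sub.comp hf (.const 1)) hg).and (primrecPred_cell hn hf hg))))
    (.pair (.const _) hr) (.ite
    ((primrecPred_eq hf (primrec_side hn)).and (primrecPred_eq hg (Primrec.encode.comp hE)))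
    (primrec_port hr hE) (.ite
    ((primrecPred_eq hf (.const 0)).and (primrecPred_eq hg (Primrec.encode.comp hW)))
    (primrec_port hr hW) (.const _)))

theorem primrec_tile (hn : Primrec k) (hr : Primrec r) (hs : Primrec s) (hf : Primrec f)
    (hg : Primrec g) : Primrec fun a => tile (k a) (r a) (s a) (f a) (g a) :=
  .pair (primrec_vglue hn hr hs hf (primrec_add hg (.const 1)))
    (.pair (primrec_hglue hn hr hs (primrec_add hf (.const 1)) hg)
      (.pair (primrec_vglue hn hr hs hf hg) (primrec_hglue hn hr hs hf hg)))

/-- The code of `y ≥ 0` is `2 * y` and that of `-(y + 1)` is `2 * y + 1`. On codes, the affine map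
becomes arithmetic of natural numbers, with a case distinction on the signs of `x` and of the value.
-/
theorem encode_mul_add (m i : ℕ) (x : ℤ) : encode (m * x + i : ℤ) =
    if encode x % 2 = 0 then 2 * (m * (encode x / 2) + i)
    else if m * (encode x / 2 + 1) ≤ i then 2 * (i - m * (encode x / 2 + 1))
    else 2 * (m * (encode x / 2 + 1) - i - 1) + 1 := by
  have e1 : ∀ y : ℕ, encode (y : ℤ) = 2 * y := fun _ => rfl
  have e2 : ∀ y : ℕ, encode (Int.negSucc y) = 2 * y + 1 := fun _ => rfl
  cases x with
  | ofNat y =>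
    rw [Int.ofNat_eq_natCast, e1, if_pos (by omega), show 2 * y / 2 = y by omega, ← e1]
    push_cast
    rfl
  | negSucc y =>
    rw [e2, if_neg (by omega), show (2 * y + 1) / 2 = y by omega]
    split_ifs with h
    · rw [← e1, Int.negSucc_eq]
      congr 1
      push_cast [Nat.cast_sub h]
      ring
    · rw [← e2, Int.negSucc_eq, Int.negSucc_eq]
      congr 1
      rw [Nat.cast_sub (by omega), Nat.cast_sub (by omega)]
      push_cast
      ring

theorem primrec_int_mul_add {x : σ → ℤ} (hf : Primrec f) (hx : Primrec x) (hg : Primrec g) :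
    Primrec fun a => (f a * x a + g a : ℤ) := by
  refine Primrec.encode_iff.1 ?_
  simp only [encode_mul_add]
  have he := Primrec.encode.comp hx
  have hh := Primrec.nat_div.comp he (.const 2)
  have hm := primrec_mul hf (primrec_add hh (.const 1))
  exact .ite (primrecPred_eq (Primrec.nat_mod.comp he (.const 2)) (.const 0))
    (primrec_mul (.const 2) (primrec_add (primrec_mul hf hh) hg))
    (.ite (primrecPred_le hm hg) (primrec_mul (.const 2) (Primrec.nat_sub.comp hg hm))
      (primrec_add (primrec_mul (.const 2)
        (Primrec.nat_sub.comp (Primrec.nat_sub.comp hm hg) (.const 1))) (.const 1)))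

theorem primrec_pos {x : σ → ℤ × ℤ} (hn : Primrec k) (hx : Primrec x) (hf : Primrec f)
    (hg : Primrec g) : Primrec fun a => pos (k a) (x a) (f a) (g a) :=
  .pair (primrec_int_mul_add (primrec_side hn) (Primrec.fst.comp hx) hf)
    (primrec_int_mul_add (primrec_side hn) (Primrec.snd.comp hx) hg)

theorem primrec_cellList : Primrec cellList := by
  have h : Primrec fun n : ℕ => List.range (2 * n + 5) :=
    Primrec.list_range.comp (primrec_add (primrec_mul (.const 2) .id) (.const 5))
  have h1 : Primrec fun n : ℕ => (List.range (2 * n + 5)).flatMap fun i =>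
      (List.range (2 * n + 5)).map fun j => (i, j) :=
    Primrec.list_flatMap h (Primrec.list_map (h.comp Primrec.fst)
      (Primrec₂.pair.comp₂ (Primrec.snd.comp₂ Primrec₂.left) Primrec₂.right))
  have h2 : PrimrecRel fun (c : ℕ × ℕ) (n : ℕ) => Cell n c.1 c.2 :=
    primrecPred_cell Primrec.snd (Primrec.fst.comp Primrec.fst) (Primrec.snd.comp Primrec.fst)
  exact h2.listFilter.comp h1 .id

theorem primrec_expandList {l : σ → FinAssembly} (hn : Primrec k) (hr : Primrec r)
    (hl : Primrec l) : Primrec fun a => expandList (k a) (r a) (l a) := by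
  refine Primrec.list_flatMap hl (Primrec.list_map
    (primrec_cellList.comp (hn.comp Primrec.fst)) ?_)
  have a1 : Primrec fun y : (σ × ((ℤ × ℤ) × TileType)) × (ℕ × ℕ) => y.1.1 :=
    Primrec.fst.comp Primrec.fst
  have a2 : Primrec fun y : (σ × ((ℤ × ℤ) × TileType)) × (ℕ × ℕ) => y.1.2 :=
    Primrec.snd.comp Primrec.fst
  have a3 : Primrec fun y : (σ × ((ℤ × ℤ) × TileType)) × (ℕ × ℕ) => y.2.1 :=
    Primrec.fst.comp Primrec.snd
  have a4 : Primrec fun y : (σ × ((ℤ × ℤ) × TileType)) × (ℕ × ℕ) => y.2.2 :=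
    Primrec.snd.comp Primrec.snd
  exact Primrec.pair (primrec_pos (hn.comp a1) (Primrec.fst.comp a2) a3 a4)
    (primrec_tile (hn.comp a1) (hr.comp a1) (Primrec.snd.comp a2) a3 a4)

theorem primrec_blockLabel {b : σ → Block} (hb : Primrec b) (hf : Primrec f) (hg : Primrec g) :
    Primrec fun a => blockLabel (b a) (f a) (g a) := by
  have h1 := (Primrec.list_getD ([] : List (Option TileType))).comp hb hg
  have h2 := (Primrec.list_getD (none : Option TileType)).comp h1 hf
  have h3 : Primrec fun o : Option TileType => o.map fun t => t.1.1 :=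
    Primrec.option_map₁ (Primrec.fst.comp Primrec.fst)
  exact Primrec.option_getD.comp (h3.comp h2) (.const [])

theorem primrecPred_exists_lt {R : σ → ℕ → Prop} (hf : Primrec f)
    (hR : PrimrecPred fun y : σ × ℕ => R y.1 y.2) : PrimrecPred fun a => ∃ x < f a, R a x := by
  have h : PrimrecRel fun (x : ℕ) (a : σ) => R a x := hR.comp (Primrec.pair Primrec.snd Primrec.fst)
  refine (h.exists_mem_list.comp (Primrec.list_range.comp hf) .id).of_eq fun a => ?_
  simp

theorem primrecPred_shows {b : σ → Block} (hn : Primrec k) (hb : Primrec b) (hs : Primrec s) :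
    PrimrecPred fun a => Shows (k a) (b a) (s a) := by
  have hside : Primrec fun a => side (k a) := primrec_side hn
  refine primrecPred_exists_lt hside (primrecPred_exists_lt (hside.comp Primrec.fst) ?_)
  have a1 : Primrec fun y : (σ × ℕ) × ℕ => y.1.1 := Primrec.fst.comp Primrec.fst
  have a2 : Primrec fun y : (σ × ℕ) × ℕ => y.1.2 := Primrec.snd.comp Primrec.fst
  have a3 : Primrec fun y : (σ × ℕ) × ℕ => y.2 := Primrec.snd
  have l1 := primrec_blockLabel (hb.comp a1) a2 a3
  have l2 := primrec_blockLabel (hb.comp a1)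
    (primrec_add (primrec_add a2 (Primrec.encode.comp (hs.comp a1))) (.const 1)) a3
  exact ((Primrec.eq.comp l1 (.const _)).and (Primrec.eq.comp l2 (.const _))).or
    ((Primrec.eq.comp l1 (.const _)).and (Primrec.eq.comp l2 (.const _)))

theorem primrec_represent {l : σ → List TileType} {b : σ → Block} (hn : Primrec k)
    (hl : Primrec l) (hb : Primrec b) : Primrec fun a => represent (k a) (l a) (b a) := by
  have h : PrimrecRel fun (t : TileType) (a : σ) => Shows (k a) (b a) t :=
    primrecPred_shows (hn.comp Primrec.snd) (hb.comp Primrec.snd) Primrec.fst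
  have : DecidableRel fun (t : TileType) (a : σ) => Shows (k a) (b a) t :=
    fun t a => inferInstance
  -- The first element found is the head of the filtered list.
  refine (Primrec.list_head?.comp (h.listFilter.comp hl .id)).of_eq fun a => ?_
  rw [List.head?_filter, represent]
  congr
  funext t
  exact decide_eq_decide.2 Iff.rfl

end Primrec

/-- List codes are iterated pairings, and the pairing function dominates its arguments. This makes
the code of the tile list an admissible, computable choice of `n`. -/
theorem encode_le_of_mem {ι : Type*} [Encodable ι] {l : List ι} {a : ι} (h : a ∈ l) :
    encode a ≤ encode l := by
  induction l with
  | nil => simp at h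
  | cons b l ih =>
    rw [encode_list_cons]
    rcases List.mem_cons.1 h with rfl | h
    · exact (Nat.left_le_pair _ _).trans (Nat.le_succ _)
    · exact (ih h).trans ((Nat.right_le_pair _ _).trans (Nat.le_succ _))

theorem fits_of_mem {l : List TileType} (h : t ∈ l) : Fits (encode l) t := by
  have h0 := encode_le_of_mem h
  have h1 : encode t.1 ≤ encode t := Nat.left_le_pair _ _
  have h2 : encode t.2 ≤ encode t := Nat.right_le_pair _ _
  have h3 : encode t.2.1 ≤ encode t.2 := Nat.left_le_pair _ _
  have h4 : encode t.2.2 ≤ encode t.2 := Nat.right_le_pair _ _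
  have h5 : encode t.2.2.1 ≤ encode t.2.2 := Nat.left_le_pair _ _
  have h6 : encode t.2.2.2 ≤ encode t.2.2 := Nat.right_le_pair _ _
  exact ⟨h0, by omega, by omega, by omega, by omega⟩

end MacroTile

namespace MacroTile

open Assembly Encodable

variable {n τ : ℕ} {i j : ℕ} {p q w : ℤ × ℤ} {t : TileType} {α β : Assembly}
  {A B G X : Set Assembly} {T : Finset TileType}

/-! ### The universal tile set -/

/-- The glues of the universal tile set. -/
def glues (τ : ℕ) : Finset Glue :=
  {([], 0), (plain, τ), (centre, τ), (mark, τ)} ∪ (Finset.range (τ + 1)).image fun s => (port, s)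

/-- The universal tile set. -/
def universal (τ : ℕ) : Finset TileType := glues τ ×ˢ glues τ ×ˢ glues τ ×ˢ glues τ

theorem port_mem_glues (x : ℕ) : (port, min x τ) ∈ glues τ := by
  simp [glues]

theorem vglue_mem_glues : vglue n τ t i j ∈ glues τ := by
  unfold vglue
  split_ifs
  · unfold label; split_ifs <;> simp [glues]
  all_goals first | exact port_mem_glues _ | simp [glues]

theorem hglue_mem_glues : hglue n τ t i j ∈ glues τ := by
  unfold hglue
  split_ifs
  · simp [glues]
  all_goals first | exact port_mem_glues _ | simp [glues]

theorem expand_over : (expand n τ α).Over (universal τ) := by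
  intro P s h
  simp only [expand, Option.map_eq_some_iff] at h
  obtain ⟨t, -, rfl⟩ := h
  simp [universal, tile, vglue_mem_glues, hglue_mem_glues]

/-! ### The number of tiles -/

/-- Reduction modulo the side length moves each bump into the opposite dent and is injective on
cells. -/
theorem card_cells : (cellList n).toFinset.card ≤ side n ^ 2 := by
  have : (Finset.range (side n) ×ˢ Finset.range (side n)).card = side n ^ 2 := by
    rw [Finset.card_product, Finset.card_range, sq]
  rw [← this]
  have hpos : 0 < side n := by simp [side]
  refine Finset.card_le_card_of_injOn (fun c => (c.1 % side n, c.2 % side n)) ?_ ?_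
  · intro c _
    simp [Nat.mod_lt _ hpos]
  · have key : ∀ a, a ≤ 2 * n + 4 → a % side n = a ∧ a < 2 * n + 4 ∨
        a % side n = 0 ∧ a = 2 * n + 4 := by
      intro a ha
      rcases ha.lt_or_eq with h | rfl
      · exact Or.inl ⟨Nat.mod_eq_of_lt h, h⟩
      · exact Or.inr ⟨Nat.mod_self _, rfl⟩
    rintro ⟨a, b⟩ h ⟨a', b'⟩ h' he
    simp only [Finset.mem_coe, List.mem_toFinset, mem_cellList, Prod.mk.injEq] at h h' he ⊢
    have le : ∀ {a b}, Cell n a b → a ≤ 2 * n + 4 ∧ b ≤ 2 * n + 4 := by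
      rintro a b (h | h | h) <;> omega
    have k1 := key a (le h).1
    have k2 := key b (le h).2
    have k3 := key a' (le h').1
    have k4 := key b' (le h').2
    unfold Cell at h h'
    omega

theorem dom_expand_subset : (expand n τ α).dom ⊆
    (fun x : (ℤ × ℤ) × (ℕ × ℕ) => pos n x.1 x.2.1 x.2.2) ''
      (α.dom ×ˢ ((cellList n).toFinset : Set (ℕ × ℕ))) := by
  intro P hP
  obtain ⟨⟨p, i, j⟩, hc, rfl⟩ := exists_pos n P
  exact ⟨(p, i, j), ⟨(pos_mem_dom_expand hc).1 hP, by simpa [mem_cellList] using hc⟩, rfl⟩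

theorem dom_expand_finite (h : α.dom.Finite) : (expand n τ α).dom.Finite :=
  ((h.prod (Finset.finite_toSet _)).image _).subset dom_expand_subset

theorem ncard_dom_expand (h : α.dom.Finite) :
    (expand n τ α).dom.ncard ≤ side n ^ 2 * α.dom.ncard := by
  have hf := h.prod (Finset.finite_toSet (cellList n).toFinset)
  calc (expand n τ α).dom.ncard ≤ _ := Set.ncard_le_ncard dom_expand_subset (hf.image _)
    _ ≤ _ := Set.ncard_image_le hf
    _ = α.dom.ncard * (cellList n).toFinset.card := by rw [Set.ncard_prod, Set.ncard_coe_finset]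
    _ ≤ _ := by rw [mul_comm]; exact Nat.mul_le_mul_right _ card_cells

theorem ncard_dom_translate : (α.translate w).dom.ncard = α.dom.ncard := by
  rw [← Set.ncard_image_of_injective α.dom (add_left_injective w)]
  congr 1
  ext P
  simp [mem_dom_translate, sub_eq_add_neg]

/-! ### Supertiles of macrotiles -/

/-- The supertile of the macrotile assemblies of the members of a supertile. -/
def expandSet (n τ : ℕ) (A : Set Assembly) : Set Assembly :=
  {P | ∃ α ∈ A, P ∈ (expand n τ α).supertile}

theorem expandSet_supertile :
    expandSet n τ α.supertile = (expand n τ α).supertile := by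
  ext P
  constructor
  · rintro ⟨_, ⟨v, rfl⟩, h⟩
    rwa [expand_translate, supertile_translate] at h
  · exact fun h => ⟨α, mem_supertile_self, h⟩

/-- `A` is the supertile of a non-empty assembly over `T`. -/
def Proper (T : Finset TileType) (A : Set Assembly) : Prop :=
  ∃ α : Assembly, A = α.supertile ∧ α.Over T ∧ α.dom.Nonempty

theorem proper_supertile : Proper T α.supertile ↔ α.Over T ∧ α.dom.Nonempty := by
  constructor
  · rintro ⟨β, h, h1, h2⟩
    obtain ⟨u, rfl⟩ := exists_of_supertile_eq h.symm
    exact ⟨h1.translate u, dom_translate_nonempty h2⟩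
  · exact fun h => ⟨α, rfl, h⟩

theorem proper_of_mem_combination (hA : Proper T A) (hB : Proper T B)
    (hG : G ∈ combination τ A B) : Proper T G := by
  obtain ⟨α, rfl, hα, hα'⟩ := hA
  obtain ⟨β, rfl, hβ, -⟩ := hB
  obtain ⟨u, v, -, -, rfl⟩ := mem_combination_supertile.1 hG
  exact ⟨_, rfl, (hα.translate u).union (hβ.translate v), by
    rw [dom_union]; exact (dom_translate_nonempty hα').inl⟩

theorem allFit_of_over (hT : ∀ t ∈ T, Fits n t) (h : α.Over T) : AllFit n α :=
  fun p t hp => hT t (h p t hp)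

theorem AllFit.union (hα : AllFit n α) (hβ : AllFit n β) : AllFit n (α.union β) := by
  intro p t hp
  simp only [Assembly.union, Option.or_eq_some_iff] at hp
  rcases hp with hp | ⟨-, hp⟩
  exacts [hα _ _ hp, hβ _ _ hp]

/-- A stable attachment of macrotile assemblies is a stable attachment of the represented
assemblies. -/
theorem exists_shift_of_stable (hτ : 0 < τ) (hα : AllFit n α) (hβ : AllFit n β)
    (hα' : α.dom.Nonempty) (hβ' : β.dom.Nonempty)
    (hd : Disjoint (expand n τ α).dom ((expand n τ β).translate w).dom)
    (hs : ((expand n τ α).union ((expand n τ β).translate w)).Stable τ) :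
    ∃ v, w = shift n v ∧ Disjoint α.dom (β.translate v).dom ∧
      (α.union (β.translate v)).Stable τ := by
  obtain ⟨v, rfl⟩ : ∃ v, w = shift n v := by
    obtain ⟨v, hv⟩ := aligned_of_stable (w := 0) (w' := w) hτ hα hβ hα' hβ'
      (by rwa [translate_zero]) (by rwa [translate_zero])
    exact ⟨v, by rw [hv, zero_add]⟩
  rw [← expand_translate] at hd hs
  rw [← expand_union, stable_expand (hα.union (hβ.translate v))] at hs
  exact ⟨v, rfl, disjoint_expand.1 hd, hs⟩

/-- The offset of two expansions that combine stably is a multiple of the side length, so it comes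
from an offset of the represented assemblies; disjointness and stability then transfer in both
directions. -/
theorem mem_combination_expandSet (hτ : 0 < τ) (hT : ∀ t ∈ T, Fits n t) (hA : Proper T A)
    (hB : Proper T B) : X ∈ combination τ (expandSet n τ A) (expandSet n τ B) ↔
      ∃ G ∈ combination τ A B, X = expandSet n τ G := by
  obtain ⟨α, rfl, hα, hα'⟩ := hA
  obtain ⟨β, rfl, hβ, hβ'⟩ := hB
  have fα := allFit_of_over hT hα
  have fβ := allFit_of_over hT hβ
  rw [expandSet_supertile, expandSet_supertile, mem_combination_supertile]
  constructor
  · rintro ⟨u, v, hd, hs, rfl⟩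
    -- Only the relative position matters, so the first expansion is moved back to the standard
    -- alignment.
    have e1 : ((expand n τ α).translate u).translate (-u) = expand n τ α := by
      rw [translate_translate, add_neg_cancel, translate_zero]
    have hd' := disjoint_translate (u := -u) hd
    have hs' := hs.translate (-u)
    rw [translate_union] at hs'
    rw [e1, translate_translate] at hd' hs'
    obtain ⟨x, hx, h1, h2⟩ := exists_shift_of_stable hτ fα fβ hα' hβ' hd' hs'
    refine ⟨(α.union (β.translate x)).supertile,
      ⟨α, mem_supertile_self, _, ⟨x, rfl⟩, h1, h2, rfl⟩, ?_⟩
    rw [expandSet_supertile, expand_union, expand_translate, ← hx, ← supertile_translate (u := -u),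
      translate_union, e1, translate_translate]
  · rintro ⟨G, hG, rfl⟩
    obtain ⟨u, v, hd, hs, rfl⟩ := mem_combination_supertile.1 hG
    refine ⟨shift n u, shift n v, ?_, ?_, ?_⟩
    · rw [← expand_translate, ← expand_translate]
      exact disjoint_expand.2 hd
    · rw [← expand_translate, ← expand_translate, ← expand_union]
      exact (stable_expand ((fα.translate u).union (fβ.translate v))).2 hs
    · rw [expandSet_supertile, expand_union, expand_translate, expand_translate]

/-! ### Productions -/

section Productions

variable {S U : TAS}

theorem proper_of_init (hS : S.WellFormed) (hA : A ∈ S.init) : Proper S.tiles A := by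
  obtain ⟨α, rfl, -, h1, h2, -⟩ := hS.2 A hA
  exact ⟨α, rfl, h2, h1⟩

theorem proper_of_finProducible (hS : S.WellFormed) (hA : S.FinProducible A) :
    Proper S.tiles A := by
  induction hA with
  | init h => exact proper_of_init hS h
  | combine _ _ h ih ih' => exact proper_of_mem_combination ih ih' h

theorem proper_of_attach (hS : S.WellFormed) (hα : α.Over S.tiles ∧ α.dom.Nonempty)
    (h : S.Attach {B | S.FinProducible B} α β) : β.Over S.tiles ∧ β.dom.Nonempty := by
  rcases h with rfl | ⟨γ, h1, -, rfl, -⟩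
  · exact hα
  · exact ⟨hα.1.union (proper_supertile.1 (proper_of_finProducible hS h1)).1, by
      rw [dom_union]; exact hα.2.inl⟩

theorem proper_of_isGrowth (hS : S.WellFormed) {a : ℕ → Assembly} (h0 : (a 0).supertile ∈ S.init)
    (ha : S.IsGrowth {B | S.FinProducible B} a) (k : ℕ) :
    (a k).Over S.tiles ∧ (a k).dom.Nonempty := by
  induction k with
  | zero => exact proper_supertile.1 (proper_of_init hS h0)
  | succ k ih => exact proper_of_attach hS ih (ha.attach k)

theorem proper_of_producible (hS : S.WellFormed) (hA : A ∈ S.producible) :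
    Proper S.tiles A := by
  obtain ⟨a, γ, h0, ha, hr, rfl⟩ := hA
  have h := proper_of_isGrowth hS h0 ha
  refine ⟨γ, rfl, fun p t hp => ?_, (h 0).2.mono (hr.dom_subset 0)⟩
  obtain ⟨k, hk⟩ := (hr p t).1 hp
  exact (h k).1 p t hk

/-- `U` has the macrotile versions of the initial supertiles of `S`. -/
structure Expands (n : ℕ) (U S : TAS) : Prop where
  wellFormed : S.WellFormed
  fits : ∀ t ∈ S.tiles, Fits n t
  temp_pos : 0 < S.temp
  temp_eq : U.temp = S.temp
  init_eq : U.init = expandSet n S.temp '' S.init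

namespace Expands

theorem finProducible_iff (h : Expands n U S) :
    U.FinProducible X ↔ ∃ A, S.FinProducible A ∧ X = expandSet n S.temp A := by
  constructor
  · intro hX
    induction hX with
    | init hA =>
      rw [h.init_eq] at hA
      obtain ⟨A, hA, rfl⟩ := hA
      exact ⟨A, .init hA, rfl⟩
    | combine _ _ hG ih ih' =>
      obtain ⟨A, hA, rfl⟩ := ih
      obtain ⟨B, hB, rfl⟩ := ih'
      rw [h.temp_eq, mem_combination_expandSet h.temp_pos h.fits
        (proper_of_finProducible h.wellFormed hA) (proper_of_finProducible h.wellFormed hB)] at hG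
      obtain ⟨G, hG, rfl⟩ := hG
      exact ⟨G, .combine hA hB hG, rfl⟩
  · rintro ⟨A, hA, rfl⟩
    induction hA with
    | init hA => exact .init (by rw [h.init_eq]; exact ⟨_, hA, rfl⟩)
    | combine hA hB hG ih ih' =>
      refine .combine ih ih' ?_
      rw [h.temp_eq, mem_combination_expandSet h.temp_pos h.fits
        (proper_of_finProducible h.wellFormed hA) (proper_of_finProducible h.wellFormed hB)]
      exact ⟨_, hG, rfl⟩

theorem attach_expand (h : Expands n U S) (hα : α.Over S.tiles)
    (ha : S.Attach {B | S.FinProducible B} α β) :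
    U.Attach {B | U.FinProducible B} (expand n S.temp α) (expand n S.temp β) := by
  rcases ha with rfl | ⟨γ, h1, h2, rfl, h4⟩
  · exact Or.inl rfl
  · refine Or.inr ⟨expand n S.temp γ, h.finProducible_iff.2 ⟨_, h1, expandSet_supertile.symm⟩,
      disjoint_expand.2 h2, expand_union, ?_⟩
    have hγ := (proper_supertile.1 (proper_of_finProducible h.wellFormed h1)).1
    rw [h.temp_eq]
    exact stable_expand_of_stable (allFit_of_over h.fits (hα.union hγ)) h4

theorem exists_of_attach (h : Expands n U S) (hα : α.Over S.tiles ∧ α.dom.Nonempty)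
    (ha : U.Attach {B | U.FinProducible B} (expand n S.temp α) β) :
    ∃ α', S.Attach {B | S.FinProducible B} α α' ∧ β = expand n S.temp α' := by
  rcases ha with rfl | ⟨β', h1, h2, rfl, h4⟩
  · exact ⟨α, Or.inl rfl, rfl⟩
  · obtain ⟨C, hC, hβ'⟩ := h.finProducible_iff.1 h1
    obtain ⟨γ, rfl, hγ, hγ'⟩ := proper_of_finProducible h.wellFormed hC
    rw [expandSet_supertile] at hβ'
    obtain ⟨w, rfl⟩ := exists_of_supertile_eq hβ'.symm
    rw [h.temp_eq] at h4
    obtain ⟨v, rfl, h5, h6⟩ := exists_shift_of_stable h.temp_pos (allFit_of_over h.fits hα.1)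
      (allFit_of_over h.fits hγ) hα.2 hγ' h2 h4
    refine ⟨α.union (γ.translate v), Or.inr ⟨γ.translate v, ?_, h5, rfl, h6⟩, ?_⟩
    · rwa [supertile_translate]
    · rw [expand_union, expand_translate]

/-- Growth sequences correspond term by term. Once the initial assembly is aligned, every attachment
keeps the alignment, so each stage is an expansion, and so is the result. -/
theorem producible_eq (h : Expands n U S) {l : List TileType} (hl : S.tiles = l.toFinset) :
    U.producible = expandSet n S.temp '' S.producible := by
  have hfit : ∀ t ∈ l, Fits n t := fun t ht => h.fits t (by rw [hl]; exact List.mem_toFinset.2 ht)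
  have result : ∀ {a : ℕ → Assembly} {γ : Assembly}, TAS.IsResult a γ →
      TAS.IsResult (fun k => expand n S.temp (a k)) (expand n S.temp γ) := by
    intro a γ hr P s
    simp only [expand, Option.map_eq_some_iff, hr _ _]
    constructor
    · rintro ⟨t, ⟨k, hk⟩, hs⟩; exact ⟨k, t, hk, hs⟩
    · rintro ⟨k, t, hk, hs⟩; exact ⟨t, ⟨k, hk⟩, hs⟩
  ext X
  constructor
  · rintro ⟨b, γ', h0, hb, hr, rfl⟩
    rw [h.init_eq] at h0
    obtain ⟨A, hA, h0⟩ := h0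
    obtain ⟨α, rfl, hα⟩ := proper_of_init h.wellFormed hA
    rw [expandSet_supertile] at h0
    obtain ⟨w, hw⟩ := exists_of_supertile_eq h0.symm
    have hb' := hb.translate w
    have hr' := hr.translate w
    -- Representation serves as an explicit inverse of expansion, so no stage has to be chosen.
    set a : ℕ → Assembly := fun k =>
      repAssembly (side n) (represent n l) ((b k).translate w) with hadef
    have hrep : ∀ {α : Assembly}, α.Over S.tiles →
        repAssembly (side n) (represent n l) (expand n S.temp α) = α := fun hα =>
      repAssembly_expand_zero hfit (hl ▸ hα)
    have key : ∀ k, ((a k).Over S.tiles ∧ (a k).dom.Nonempty) ∧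
        (b k).translate w = expand n S.temp (a k) := by
      intro k
      induction k with
      | zero =>
        have : a 0 = α := by simp only [hadef, hw, hrep hα.1]
        rw [this]
        exact ⟨hα, hw⟩
      | succ k ih =>
        have h1 := hb'.attach k
        simp only [ih.2] at h1
        obtain ⟨α', h2, h3⟩ := h.exists_of_attach ih.1 h1
        have h4 := proper_of_attach h.wellFormed ih.1 h2
        have : a (k + 1) = α' := by simp only [hadef, h3, hrep h4.1]
        rw [this]
        exact ⟨h4, h3⟩
    have ha : S.IsGrowth {B | S.FinProducible B} a := by
      intro k
      change S.Attach _ _ _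
      have h1 := hb'.attach k
      simp only [(key k).2] at h1
      obtain ⟨α', h2, h3⟩ := h.exists_of_attach (key k).1 h1
      have h4 := proper_of_attach h.wellFormed (key k).1 h2
      have : a (k + 1) = α' := by
        change repAssembly _ _ _ = _
        rw [h3, hrep h4.1]
      rwa [this]
    obtain ⟨γ, hγ⟩ := ha.exists_result
    have e : γ'.translate w = expand n S.temp γ := by
      refine hr'.unique ?_
      have : (fun k => (b k).translate w) = fun k => expand n S.temp (a k) :=
        funext fun k => (key k).2
      rw [this]
      exact result hγ
    refine ⟨γ.supertile, ⟨a, γ, ?_, ha, hγ, rfl⟩, ?_⟩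
    · have : a 0 = α := by simp only [hadef, hw, hrep hα.1]
      rwa [this]
    · rw [expandSet_supertile, ← e, supertile_translate]
  · rintro ⟨_, ⟨a, γ, h0, ha, hr, rfl⟩, rfl⟩
    refine ⟨_, _, ?_, fun k => ?_, result hr, expandSet_supertile⟩
    · rw [h.init_eq, ← expandSet_supertile]
      exact ⟨_, h0, rfl⟩
    · exact h.attach_expand (proper_of_isGrowth h.wellFormed h0 ha k).1 (ha.attach k)

end Expands

end Productions

end MacroTile

namespace MacroTile

open Assembly Encodable

variable {n τ : ℕ} {A B G : Set Assembly} {S U : TAS} {l : List TileType}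

/-! ### Simulation -/

namespace Expands

theorem repSupertile_expandSet (h : Expands n U S) (hl : S.tiles = l.toFinset)
    (hA : Proper S.tiles A) :
    repSupertile (side n) (represent n l) (expandSet n τ A) = A := by
  obtain ⟨α, rfl, hα, -⟩ := hA
  rw [expandSet_supertile]
  exact repSupertile_expand (fun t ht => h.fits t (by rw [hl]; exact List.mem_toFinset.2 ht))
    (hl ▸ hα)

theorem equivalentProductions (h : Expands n U S) (hl : S.tiles = l.toFinset) :
    EquivalentProductions (side n) (represent n l) U S := by
  have hrep : ∀ A ∈ S.producible,
      repSupertile (side n) (represent n l) (expandSet n S.temp A) = A := fun A hA =>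
    h.repSupertile_expandSet hl (proper_of_producible h.wellFormed hA)
  rw [EquivalentProductions, h.producible_eq hl]
  constructor
  · ext B
    constructor
    · rintro ⟨_, ⟨A, hA, rfl⟩, rfl⟩
      rwa [hrep A hA]
    · exact fun hB => ⟨_, ⟨B, hB, rfl⟩, hrep B hB⟩
  · rintro _ ⟨A, hA, rfl⟩
    obtain ⟨α, hα, hα', -⟩ := proper_of_producible h.wellFormed hA
    refine ⟨⟨α, hα', (hrep A hA).trans hα⟩, expand n S.temp α, ?_, ?_⟩
    · rw [hα, expandSet_supertile]
      exact mem_supertile_self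
    · rw [repAssembly_expand_zero
        (fun t ht => h.fits t (by rw [hl]; exact List.mem_toFinset.2 ht)) (hl ▸ hα')]
      exact cleanTo_expand

theorem expandSet_mem_combination (h : Expands n U S) (hA : A ∈ S.producible)
    (hB : B ∈ S.producible) (hG : G ∈ combination S.temp A B) :
    expandSet n S.temp G ∈
      combination U.temp (expandSet n S.temp A) (expandSet n S.temp B) := by
  rw [h.temp_eq, mem_combination_expandSet h.temp_pos h.fits
    (proper_of_producible h.wellFormed hA) (proper_of_producible h.wellFormed hB)]
  exact ⟨G, hG, rfl⟩

theorem follows (h : Expands n U S) (hl : S.tiles = l.toFinset) :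
    Follows (side n) (represent n l) U S := by
  rw [Follows, h.producible_eq hl]
  rintro _ ⟨A, hA, rfl⟩ _ ⟨B, hB, rfl⟩ ⟨X, hX, hc⟩
  rw [h.producible_eq hl] at hX
  obtain ⟨C, hC, rfl⟩ := hX
  have pA := proper_of_producible h.wellFormed hA
  have pB := proper_of_producible h.wellFormed hB
  have pC := proper_of_producible h.wellFormed hC
  rw [h.temp_eq, mem_combination_expandSet h.temp_pos h.fits pA pC] at hc
  obtain ⟨G, hG, e⟩ := hc
  rw [h.repSupertile_expandSet hl pA, e,
    h.repSupertile_expandSet hl (proper_of_mem_combination pA pC hG)]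
  exact Or.inr ⟨C, hC, hG⟩

theorem grows_refl {A : Set Assembly} (hA : Proper S.tiles A) :
    U.Grows (expandSet n τ A) (expandSet n τ A) := by
  obtain ⟨α, rfl, -⟩ := hA
  rw [expandSet_supertile]
  exact ⟨fun _ => expand n τ α, expand n τ α, rfl, fun _ => Or.inl rfl, by simp [TAS.IsResult],
    rfl⟩

/-- Representation is injective on the producible supertiles of the simulator, so the given
supertile is the expansion of `A` and is ready for the step without growing. -/
theorem weaklyModels (h : Expands n U S) (hl : S.tiles = l.toFinset) :
    WeaklyModels (side n) (represent n l) U S := by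
  rw [WeaklyModels, h.producible_eq hl]
  rintro A hA B hB ⟨X, hX, hc⟩ _ ⟨A', hA', rfl⟩ hrep
  have pA := proper_of_producible h.wellFormed hA
  obtain rfl : A' = A := by
    rwa [h.repSupertile_expandSet hl (proper_of_producible h.wellFormed hA')] at hrep
  refine ⟨_, ⟨A', hA, rfl⟩, hrep, grows_refl pA, _, ⟨B, hB, rfl⟩,
    ⟨expandSet n S.temp X, ?_, h.expandSet_mem_combination hA hX hc⟩,
    h.repSupertile_expandSet hl (proper_of_producible h.wellFormed hB)⟩
  rw [h.producible_eq hl]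
  exact ⟨X, hX, rfl⟩

/-- As for `weaklyModels`, but the combination must first be shown to be producible, which is
`TAS.producible_of_mem_combination`. -/
theorem stronglyModels (h : Expands n U S) (hl : S.tiles = l.toFinset) :
    StronglyModels (side n) (represent n l) U S := by
  rw [StronglyModels, h.producible_eq hl]
  rintro A hA B hB G hG _ ⟨A', hA', rfl⟩ _ ⟨B', hB', rfl⟩ hrA hrB
  have pA := proper_of_producible h.wellFormed hA
  have pB := proper_of_producible h.wellFormed hB
  obtain rfl : A' = A := by
    rwa [h.repSupertile_expandSet hl (proper_of_producible h.wellFormed hA')] at hrA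
  obtain rfl : B' = B := by
    rwa [h.repSupertile_expandSet hl (proper_of_producible h.wellFormed hB')] at hrB
  have hG' := TAS.producible_of_mem_combination h.wellFormed hA hB hG
  exact ⟨_, ⟨A', hA, rfl⟩, _, ⟨B', hB, rfl⟩, _, ⟨G, hG', rfl⟩, grows_refl pA, grows_refl pB,
    hrA, hrB, h.repSupertile_expandSet hl (proper_of_producible h.wellFormed hG'),
    h.expandSet_mem_combination hA hB hG⟩

end Expands

/-- The initial state of the simulator. -/
def start (d : Description) : List FinAssembly := d.2.1.map (expandList (encode d.1) d.2.2)

theorem stateOf_start (d : Description) :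
    stateOf (start d) = expandSet (encode d.1) d.2.2 '' stateOf d.2.1 := by
  ext A
  simp only [stateOf, start, List.mem_map, Set.mem_image]
  constructor
  · rintro ⟨_, ⟨l, hl, rfl⟩, rfl⟩
    exact ⟨_, ⟨l, hl, rfl⟩, by rw [expandSet_supertile, toAssembly_expandList]⟩
  · rintro ⟨_, ⟨l, hl, rfl⟩, rfl⟩
    exact ⟨_, ⟨l, hl, rfl⟩, by rw [expandSet_supertile, toAssembly_expandList]⟩

theorem primrec_start : Primrec start :=
  Primrec.list_map (Primrec.fst.comp Primrec.snd)
    (primrec_expandList (Primrec.encode.comp (Primrec.fst.comp Primrec.fst))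
      (Primrec.snd.comp (Primrec.snd.comp Primrec.fst)) Primrec.snd)

theorem expands_toTAS {d : Description} (hτ : 0 < τ) (hd : d.toTAS ∈ TwoHAM τ) :
    Expands (encode d.1) ⟨universal τ, stateOf (start d), τ⟩ d.toTAS where
  wellFormed := hd.1
  fits _ ht := fits_of_mem (List.mem_toFinset.1 ht)
  temp_pos := hd.2 ▸ hτ
  temp_eq := hd.2.symm
  init_eq := stateOf_start d

theorem Expands.wellFormed_universal {I : Set (Set Assembly)}
    (h : Expands n ⟨universal τ, I, τ⟩ S) : (TAS.mk (universal τ) I τ).WellFormed := by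
  have hI := h.init_eq
  have hτ := h.temp_eq
  simp only at hI hτ
  refine ⟨hI ▸ h.wellFormed.1.image _, ?_⟩
  simp only [hI]
  rintro _ ⟨A, hA, rfl⟩
  obtain ⟨α, rfl, h1, h2, h3, h4⟩ := h.wellFormed.2 A hA
  refine ⟨expand n τ α, by rw [expandSet_supertile, hτ], dom_expand_finite h1,
    dom_expand_nonempty h2, expand_over, ?_⟩
  exact stable_expand_of_stable (allFit_of_over h.fits h3) (hτ ▸ h4)

theorem Expands.init_spec (h : Expands n U S) (hl : S.tiles = l.toFinset) (hA : A ∈ U.init) :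
    repSupertile (side n) (represent n l) A ∈ S.init ∧ ∀ α ∈ A,
      α.dom.ncard ≤ side n ^ 2 * (repAssembly (side n) (represent n l) α).dom.ncard := by
  rw [h.init_eq] at hA
  obtain ⟨B, hB, rfl⟩ := hA
  refine ⟨by rwa [h.repSupertile_expandSet hl (proper_of_init h.wellFormed hB)], ?_⟩
  obtain ⟨β, rfl, h1, -, h3, -⟩ := h.wellFormed.2 B hB
  rw [expandSet_supertile]
  rintro _ ⟨w, rfl⟩
  rw [repAssembly_expand (fun t ht => h.fits t (by rw [hl]; exact List.mem_toFinset.2 ht))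
    (hl ▸ h3), ncard_dom_translate, ncard_dom_translate]
  exact ncard_dom_expand h1

/-- Scale, representation and initial state do not depend on the notion of simulation, so one
construction serves both. -/
theorem intrinsicallyUniversal {sim : ℕ → (Block → Option TileType) → TAS → TAS → Prop}
    (hsim : ∀ {n : ℕ} {l : List TileType} {U S : TAS}, Expands n U S → S.tiles = l.toFinset →
      sim (side n) (represent n l) U S) (hτ : 0 < τ) :
    IntrinsicallyUniversal sim (universal τ) τ (TwoHAM τ) := by
  refine ⟨fun d => side (encode d.1), fun d => represent (encode d.1) d.1, start, ?_, ?_,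
    primrec_start.to_comp, ?_⟩
  · exact (primrec_side (Primrec.encode.comp Primrec.fst)).to_comp
  · exact (primrec_represent (Primrec.encode.comp (Primrec.fst.comp Primrec.fst))
      (Primrec.fst.comp Primrec.fst) Primrec.snd).to_comp
  · rintro _ hS d rfl
    have h := expands_toTAS hτ hS
    exact ⟨by simp [side], fun b t hb => List.mem_toFinset.2 (List.mem_of_find?_eq_some hb),
      h.wellFormed_universal, fun A hA => h.init_spec rfl hA, hsim h rfl⟩

end MacroTile

theorem mainTheorem3 (τ : ℕ) (hτ : 2 ≤ τ) :
    ∃ U : Finset TileType,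
      IntrinsicallyUniversal Simulates U τ (TwoHAM τ) ∧
      IntrinsicallyUniversal StronglySimulates U τ (TwoHAM τ) := by
  have h0 : 0 < τ := by omega
  exact ⟨MacroTile.universal τ,
    MacroTile.intrinsicallyUniversal
      (fun h hl => ⟨h.equivalentProductions hl, h.follows hl, h.weaklyModels hl⟩) h0,
    MacroTile.intrinsicallyUniversal
      (fun h hl => ⟨h.equivalentProductions hl, h.follows hl, h.stronglyModels hl⟩) h0⟩
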